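/- **Setting.** Let $\Omega_1,\Omega_2\subset\mathbb R^3$ be simply connected bounded domains with $\overline{\Omega_2}\subset\Omega_1$. A rigid body occupies $\Omega_1\setminus\overline{\Omega_2}$ (its mass distribution is a finite measure carried by this set and not concentrated on a line through the origin). The cavity $\mathcal C:=\Omega_2$ is of class $C^2$ and is filled with a viscous liquid of constant density $\rho>0$ and viscosity $\mu>0$. The origin is the centre of mass of the whole system, and $\mathbf I$ is the inertia tensor of the whole system with respect to it. Let $H(\mathcal C)$ be the space of $\mathbf u\in L^2(\mathcal C)$ with $\operatorname{div}\mathbf u=0$ and $\mathbf u\cdot\mathbf n|_{\partial\mathcal C}=0$ (in the sense of distributions), and $\mathcal D_0^{1,2}(\mathcal C):=H(\mathcal C)\cap W^{1,2}_0(\mathcal C)$; $(\cdot,\cdot)$ and $\|\cdot\|_2$ are the inner product and norm of $L^2(\mathcal C)$. For a velocity field $\mathbf v$ put $\mathbf a:=-\rho\,\mathbf I^{-1}\cdot\int_{\mathcal C}\mathbf x\times\mathbf v$ and, for $\boldsymbol\omega_\infty\in\mathbb R^3$, $$\mathcal E:=\tfrac12\big(\rho\|\mathbf v\|_2^2-\mathbf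 a\cdot\mathbf I\cdot\mathbf a+\boldsymbol\omega_\infty\cdot\mathbf I\cdot\boldsymbol\omega_\infty\big).$$ A pair $(\mathbf v,\boldsymbol\omega_\infty)$ is a *weak solution* if (i) $\mathbf v\in C_w([0,\infty);H(\mathcal C))\cap L^\infty(0,\infty;H(\mathcal C))\cap L^2(0,\infty;\mathcal D_0^{1,2}(\mathcal C))$, where $C_w$ denotes weak continuity; (ii) $\boldsymbol\omega_\infty:[0,\infty)\to\mathbb R^3$ is in $C^1((0,\infty))\cap C([0,\infty))$; (iii) $\mathcal E(t)+\mu\int_s^t\|\nabla\mathbf v(\tau)\|_2^2\,d\tau\le\mathcal E(s)$ for $s=0$, for almost all $s>0$, and all $t\ge s$; (iv) for all $t>0$ and all $\boldsymbol\psi\in\mathcal D_0^{1,2}(\mathcal C)$, $$\rho(\mathbf v(t),\boldsymbol\psi)+\rho(\boldsymbol\omega_\infty(t)+\mathbf a(t))\cdot\!\int_{\mathcal C}\mathbf x\times\boldsymbol\psi+\int_0^t\{\rho(\mathbf v\cdot\nabla\mathbf v,\boldsymbol\psi)+2\rho((\boldsymbol\omega_\infty+\mathbf a)\times\mathbf v,\boldsymbol\psi)+\mu(\nabla\mathbf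 v,\nabla\boldsymbol\psi)\}\,d\tau=\rho(\mathbf v(0),\boldsymbol\psi)+\rho(\boldsymbol\omega_\infty(0)+\mathbf a(0))\cdot\!\int_{\mathcal C}\mathbf x\times\boldsymbol\psi,$$ $$\mathbf I\cdot\boldsymbol\omega_\infty(t)=\mathbf I\cdot\boldsymbol\omega_\infty(0)-\int_0^t(\boldsymbol\omega_\infty+\mathbf a)\times(\mathbf I\cdot\boldsymbol\omega_\infty)\,d\tau.$$ Its $\Omega$-limit set $\Omega(\mathbf v,\boldsymbol\omega_\infty)$ is the set of $(\mathbf V,\mathbf p)\in H(\mathcal C)\times\mathbb R^3$ for which there is an increasing unbounded sequence $\{t_n\}\subset(0,\infty)$ with $\lim_{n\to\infty}\big(\|\mathbf v(t_n)-\mathbf V\|_2+|\boldsymbol\omega_\infty(t_n)-\mathbf p|\big)=0$. **Proposition 3.** Let $(\mathbf v,\boldsymbol\omega_\infty)$ be a weak solution. Then $\Omega(\mathbf v,\boldsymbol\omega_\infty)$ is nonempty and $$\Omega(\mathbf v,\boldsymbol\omega_\infty)=\{\mathbf 0\}\times\mathcal A,$$ where $\mathcal A\subset\mathbb R^3$ is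 compact, connected, and invariant under the semigroup of the Euler equation $$\mathbf I\cdot\dot{\mathbf w}+\mathbf w\times(\mathbf I\cdot\mathbf w)=\mathbf 0,\qquad \mathbf w\in C^1((0,\infty))\cap C([0,\infty)).$$ That is: from every $\mathbf p\in\mathcal A$ there starts a solution defined for all $t\ge 0$; every solution with $\mathbf w(0)\in\mathcal A$ satisfies $\mathbf w(t)\in\mathcal A$ for all $t\ge0$; and for all $t\ge 0$ every point of $\mathcal A$ is the value $\mathbf w(t)$ of a solution with $\mathbf w(0)\in\mathcal A$. -/

import Mathlib

open MeasureTheory Set Filter Topology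

noncomputable section

namespace LiquidBody

/-- Euclidean three-dimensional space. -/
abbrev E3 : Type := EuclideanSpace ℝ (Fin 3)

/-- Second-order tensors with the Euclidean (Frobenius) inner product `G_ij H_ij`. -/
abbrev Tensor : Type := EuclideanSpace ℝ (Fin 3 × Fin 3)

/-- The cross product of two vectors. -/
def cross (a b : E3) : E3 := WithLp.toLp 2 (crossProduct a.ofLp b.ofLp)

/-- The action `M · w` of a matrix on a vector. -/
def act (M : Matrix (Fin 3) (Fin 3) ℝ) (w : E3) : E3 := Matrix.toEuclideanLin M w

/-! ### The coupled system -/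

/-- An open set `U` is of class `C²`: near each boundary point it is the set where a `C²` function
with non-vanishing differential is negative. -/
def IsC2Domain (U : Set E3) : Prop :=
  ∀ p ∈ frontier U, ∃ r > 0, ∃ f : E3 → ℝ, ContDiffOn ℝ 2 f (Metric.ball p r) ∧
    (∀ x ∈ Metric.ball p r, fderiv ℝ f x ≠ 0) ∧ ∀ x ∈ Metric.ball p r, (x ∈ U ↔ f x < 0)

/-- The inertia tensor, with respect to the origin, of a mass distribution:
`I_ij = ∫ (|x|² δ_ij - x_i x_j) dm(x)`. -/
def inertiaTensor (m : Measure E3) : Matrix (Fin 3) (Fin 3) ℝ :=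
  Matrix.of fun i j => ∫ x, (‖x‖ ^ 2 * (if i = j then 1 else 0) - x i * x j) ∂m

/-- A rigid body `outer \ closure cavity` whose cavity `cavity` is completely filled with a viscous
liquid of constant density `rho` and shear viscosity `mu`, described in a body-fixed frame with
origin at the centre of mass of the whole system. -/
structure SolidLiquid where
  outer : Set E3
  cavity : Set E3
  isOpen_outer : IsOpen outer
  isOpen_cavity : IsOpen cavity
  simplyConnected_outer : IsSimplyConnected outer
  simplyConnected_cavity : IsSimplyConnected cavity
  bounded_outer : Bornology.IsBounded outer
  bounded_cavity : Bornology.IsBounded cavity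
  closure_cavity_subset : closure cavity ⊆ outer
  cavity_C2 : IsC2Domain cavity
  /-- density of the liquid -/
  rho : ℝ
  rho_pos : 0 < rho
  /-- shear viscosity of the liquid -/
  mu : ℝ
  mu_pos : 0 < mu
  /-- mass distribution of the rigid body -/
  bodyMass : Measure E3
  bodyMass_finite : IsFiniteMeasure bodyMass
  bodyMass_carried : bodyMass (outer \ closure cavity)ᶜ = 0
  /-- The mass of the body is not concentrated on a line through the centre of mass. -/
  bodyMass_nondegenerate : ∀ e : E3, bodyMass ((Submodule.span ℝ {e} : Submodule ℝ E3) : Set E3)ᶜ ≠ 0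
  /-- The centre of mass of the whole system is the origin. -/
  center_of_mass : (∫ x, x ∂bodyMass) + rho • (∫ x in cavity, x) = 0

/-- The mass distribution of the whole system (body and liquid). -/
def SolidLiquid.totalMass (S : SolidLiquid) : Measure E3 :=
  S.bodyMass + ENNReal.ofReal S.rho • volume.restrict S.cavity

/-- The central inertia tensor `I` of the whole system. -/
def SolidLiquid.inertia (S : SolidLiquid) : Matrix (Fin 3) (Fin 3) ℝ := inertiaTensor S.totalMass

/-! ### Function spaces -/

/-- `L²(C)` for vector fields. -/
abbrev VecL2 (C : Set E3) : Type := Lp E3 2 (volume.restrict C)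

/-- `L²(C)` for tensor fields. -/
abbrev TenL2 (C : Set E3) : Type := Lp Tensor 2 (volume.restrict C)

theorem memLp_gradient (C : Set E3) {φ : E3 → ℝ} (h : ContDiff ℝ (⊤ : ℕ∞) φ)
    (hc : HasCompactSupport φ) : MemLp (gradient φ) 2 (volume.restrict C) := by
  have h1 : Continuous (gradient φ) :=
    (InnerProductSpace.toDual ℝ E3).symm.continuous.comp (h.continuous_fderiv (by simp))
  have h2 : HasCompactSupport (gradient φ) :=
    (hc.fderiv (𝕜 := ℝ)).comp_left (g := (InnerProductSpace.toDual ℝ E3).symm) (by simp)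
  exact h1.memLp_of_hasCompactSupport h2

theorem integrable_inner_gradient (C : Set E3) (u : VecL2 C) {φ : E3 → ℝ}
    (h : ContDiff ℝ (⊤ : ℕ∞) φ) (hc : HasCompactSupport φ) :
    Integrable (fun x => inner ℝ (u x) (gradient φ x)) (volume.restrict C) := by
  have h1 := L2.integrable_inner (𝕜 := ℝ) u ((memLp_gradient C h hc).toLp _)
  refine h1.congr ?_
  filter_upwards [(memLp_gradient C h hc).coeFn_toLp] with x hx
  rw [hx]

/-- The space `H(C)` of the fields `u ∈ L²(C)` with `div u = 0` in `C` and `u · n = 0` on `∂C`, both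
in the sense of distributions: `∫_C u · ∇φ = 0` for all `φ ∈ C_c^∞(ℝ³)`. (The `φ` supported in `C`
give `div u = 0`; then `∫_C u · ∇φ` is the normal trace of `u` tested with `φ`.) -/
def solenoidal (C : Set E3) : Submodule ℝ (VecL2 C) where
  carrier := {u | ∀ φ : E3 → ℝ, ContDiff ℝ (⊤ : ℕ∞) φ → HasCompactSupport φ →
    ∫ x in C, inner ℝ (u x) (gradient φ x) = 0}
  zero_mem' := by
    intro φ _ _
    rw [← integral_zero E3 ℝ (μ := volume.restrict C)]
    refine integral_congr_ae ?_
    filter_upwards [Lp.coeFn_zero E3 2 (volume.restrict C)] with x hx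
    rw [hx]; simp
  add_mem' := by
    intro u v hu hv φ h hc
    have h1 : ∫ x in C, inner ℝ ((u + v) x) (gradient φ x)
        = ∫ x in C, (inner ℝ (u x) (gradient φ x) + inner ℝ (v x) (gradient φ x)) := by
      refine integral_congr_ae ?_
      filter_upwards [Lp.coeFn_add u v] with x hx
      rw [hx, Pi.add_apply, inner_add_left]
    rw [h1, integral_add (integrable_inner_gradient C u h hc) (integrable_inner_gradient C v h hc),
      hu φ h hc, hv φ h hc, add_zero]
  smul_mem' := by
    intro c u hu φ h hc
    have h1 : ∫ x in C, inner ℝ ((c • u) x) (gradient φ x)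
        = ∫ x in C, c * inner ℝ (u x) (gradient φ x) := by
      refine integral_congr_ae ?_
      filter_upwards [Lp.coeFn_smul c u] with x hx
      rw [hx, Pi.smul_apply, real_inner_smul_left]
    rw [h1, integral_const_mul, hu φ h hc, mul_zero]

/-- The gradient of a differentiable vector field, with `(i, j)` entry `∂_j φ_i`. -/
def gradField (φ : E3 → E3) (x : E3) : Tensor :=
  WithLp.toLp 2 fun ij => fderiv ℝ φ x (EuclideanSpace.single ij.2 1) ij.1

/-- The pairs `(φ, ∇φ)` with `φ ∈ C_c^∞(C)`. -/
def testPairs (C : Set E3) : Set (WithLp 2 (VecL2 C × TenL2 C)) :=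
  {P | ∃ φ : E3 → E3, ContDiff ℝ (⊤ : ℕ∞) φ ∧ HasCompactSupport φ ∧ tsupport φ ⊆ C ∧
    P.fst =ᵐ[volume.restrict C] φ ∧ P.snd =ᵐ[volume.restrict C] gradField φ}

/-- The space `W_0^{1,2}(C)`, the closure of `C_c^∞(C)` in the `W^{1,2}` norm. An element `u` is
recorded together with its weak gradient, as the pair `(u, ∇u)`, so that the norm is
`(‖u‖₂² + ‖∇u‖₂²)^{1/2}`. -/
def W012 (C : Set E3) : Submodule ℝ (WithLp 2 (VecL2 C × TenL2 C)) :=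
  (Submodule.span ℝ (testPairs C)).topologicalClosure

/-- The space `D_0^{1,2}(C) = H(C) ∩ W_0^{1,2}(C)`, with elements recorded as pairs `(u, ∇u)`. -/
def D012 (C : Set E3) : Submodule ℝ (WithLp 2 (VecL2 C × TenL2 C)) :=
  W012 C ⊓ (solenoidal C).comap (WithLp.fstₗ 2 ℝ (VecL2 C) (TenL2 C))

variable {C : Set E3}

/-- The underlying field `u` of an element of `D_0^{1,2}(C)`. -/
def field (u : D012 C) : VecL2 C := (u : WithLp 2 (VecL2 C × TenL2 C)).fst

/-- The weak gradient `∇u` of an element of `D_0^{1,2}(C)`. -/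
def grad (u : D012 C) : TenL2 C := (u : WithLp 2 (VecL2 C × TenL2 C)).snd

/-- `(u · ∇u, ψ) = ∫_C u_j (∂_j u_i) ψ_i`. -/
def convection (u ψ : D012 C) : ℝ :=
  ∫ x in C, ∑ i, ∑ j, field u x j * grad u x (i, j) * field ψ x i

/-- `∫_C x × u(x) dx`. -/
def moment (u : VecL2 C) : E3 := ∫ x in C, cross x (u x)

/-! ### Weak solutions -/

namespace SolidLiquid

variable (S : SolidLiquid)

/-- The phase space `H(C)` of the liquid. -/
abbrev H : Type := solenoidal S.cavity

/-- `a = -ρ I⁻¹ · ∫_C x × v`. -/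
def aVec (u : VecL2 S.cavity) : E3 := -(S.rho • act S.inertia⁻¹ (moment u))

/-- The total energy `½ (ρ ‖v‖₂² - a · I · a + ω · I · ω)`. -/
def energy (u : VecL2 S.cavity) (w : E3) : ℝ :=
  (1 / 2) * (S.rho * ‖u‖ ^ 2 - inner ℝ (S.aVec u) (act S.inertia (S.aVec u))
    + inner ℝ w (act S.inertia w))

/-- Weak (Leray-Hopf) solutions `(v, ω_∞)`. Only times `t ≥ 0` matter. The function `Dv` is `v`
viewed as an element of `L²(0, ∞; D_0^{1,2}(C))`; it is determined by `v` for almost every time. -/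
def IsWeakSolution (v : ℝ → S.H) (ω : ℝ → E3) : Prop :=
  -- `v ∈ C_w([0, ∞); H(C))`
  (∀ ℓ : S.H →L[ℝ] ℝ, ContinuousOn (fun t => ℓ (v t)) (Ici 0)) ∧
  -- `v ∈ L^∞(0, ∞; H(C))`
  MemLp v ⊤ (volume.restrict (Ioi 0)) ∧
  -- `ω_∞ ∈ C¹((0, ∞)) ∩ C([0, ∞))`
  ContDiffOn ℝ 1 ω (Ioi 0) ∧ ContinuousOn ω (Ici 0) ∧
  -- `v ∈ L²(0, ∞; D_0^{1,2}(C))`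
  ∃ Dv : ℝ → D012 S.cavity, MemLp Dv 2 (volume.restrict (Ioi 0)) ∧
    (∀ᵐ t ∂(volume.restrict (Ioi (0 : ℝ))), field (Dv t) = (v t : VecL2 S.cavity)) ∧
    -- strong energy inequality, for `s = 0` and for almost every `s > 0`
    (∀ t, 0 ≤ t → S.energy (v t) (ω t) + S.mu * (∫ τ in (0 : ℝ)..t, ‖grad (Dv τ)‖ ^ 2)
      ≤ S.energy (v 0) (ω 0)) ∧
    (∀ᵐ s ∂(volume.restrict (Ioi (0 : ℝ))), ∀ t, s ≤ t →
      S.energy (v t) (ω t) + S.mu * (∫ τ in s..t, ‖grad (Dv τ)‖ ^ 2) ≤ S.energy (v s) (ω s)) ∧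
    -- weak form of the balance of linear momentum of the liquid
    (∀ ψ : D012 S.cavity, ∀ t, 0 < t →
      S.rho * inner ℝ (v t : VecL2 S.cavity) (field ψ)
        + S.rho * inner ℝ (ω t + S.aVec (v t)) (moment (field ψ))
        + (∫ τ in (0 : ℝ)..t, (S.rho * convection (Dv τ) ψ
            + 2 * S.rho * (∫ x in S.cavity, inner ℝ
                (cross (ω τ + S.aVec (v τ)) ((v τ : VecL2 S.cavity) x)) (field ψ x))
            + S.mu * inner ℝ (grad (Dv τ)) (grad ψ)))
      = S.rho * inner ℝ (v 0 : VecL2 S.cavity) (field ψ)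
        + S.rho * inner ℝ (ω 0 + S.aVec (v 0)) (moment (field ψ))) ∧
    -- conservation of total angular momentum
    (∀ t, 0 < t → act S.inertia (ω t) = act S.inertia (ω 0)
      - ∫ τ in (0 : ℝ)..t, cross (ω τ + S.aVec (v τ)) (act S.inertia (ω τ)))

/-- The `Ω`-limit set of `(v, ω_∞)` in `H(C) × ℝ³`. -/
def limitSet (v : ℝ → S.H) (ω : ℝ → E3) : Set (S.H × E3) :=
  {P | ∃ t : ℕ → ℝ, (∀ n, 0 < t n) ∧ StrictMono t ∧ Tendsto t atTop atTop ∧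
    Tendsto (fun n => ‖v (t n) - P.1‖ + ‖ω (t n) - P.2‖) atTop (𝓝 0)}

/-! ### The Euler equation -/

/-- Solutions `w ∈ C¹((0, ∞)) ∩ C([0, ∞))` of the Euler equation `I · ẇ + w × (I · w) = 0`. -/
def IsEulerSolution (w : ℝ → E3) : Prop :=
  ContDiffOn ℝ 1 w (Ioi 0) ∧ ContinuousOn w (Ici 0) ∧
    ∀ t, 0 < t → act S.inertia (deriv w t) + cross (w t) (act S.inertia (w t)) = 0

/-- The image of `A` at time `t` under the semigroup of the Euler equation: the values at time `t`
of the solutions that start in `A`. -/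
def eulerImage (t : ℝ) (A : Set E3) : Set E3 :=
  {q | ∃ w : ℝ → E3, S.IsEulerSolution w ∧ w 0 ∈ A ∧ w t = q}

/-- `A` is invariant under the semigroup of the Euler equation: from each point of `A` there starts
a solution defined for all `t ≥ 0`, and the semigroup maps `A` onto `A` at each time `t ≥ 0`. -/
def IsEulerInvariant (A : Set E3) : Prop :=
  (∀ p ∈ A, ∃ w : ℝ → E3, S.IsEulerSolution w ∧ w 0 = p) ∧ ∀ t, 0 ≤ t → S.eulerImage t A = A

end SolidLiquid

end LiquidBody

end

/-!
The liquid comes to rest relative to the body, and `ω_∞` then asymptotically follows the Euler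
equation.

*Decay of the velocity.* Twice the energy is `F + ω_∞ · I · ω_∞` with `F = ρ‖v‖₂² - a · I · a`. The
form `F` is coercive in `L²`, because the rigid body carries a fixed fraction of the inertia
(`exists_liquidEnergy_coercive`); together with the energy inequality this bounds `ω_∞`. By
conservation of angular momentum the rotational part changes at the rate
`-2 ω_∞ · (a × I · ω_∞) = O(‖v‖₂)`. Hence, by the energy inequality, `F` increases over a time
interval of length at most one by at most `η + D_η ∫ ‖∇v‖₂²` for every `η > 0`, while
`F ≤ ρ‖v‖₂² ≤ c‖∇v‖₂²` is integrable in time by the Poincaré inequality (`exists_poincare`). So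
`F → 0` (`tendsto_zero_of_le_add_integral`), that is, `v → 0` strongly
(`IsWeakSolution.tendsto_norm_zero`).

*The limit set.* Consequently the `Ω`-limit set is `{0} × A`, with `A` the set of cluster points of
the bounded continuous curve `ω_∞`, which is nonempty, compact and connected. Since `a → 0`, the
curve solves `ω̇ = g(ω) + e(t)` with `g` the vector field of the Euler equation and `e → 0`
(`IsWeakSolution.isAsymptoticSolution`). By Grönwall's inequality the translates `ω_∞(tₙ + ·)` with
`ω_∞(tₙ) → p` converge to a solution starting at `p`, and to every such solution
(`IsAsymptoticSolution.exists_forwardSolution`, `IsAsymptoticSolution.tendsto_shift`); this gives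
existence and both directions of the invariance.
-/

namespace LiquidBody

/-! ### Cluster points of a bounded curve -/

section ClusterPoints

variable {E : Type*} [NormedAddCommGroup E]

/-- The set of cluster points of a curve at `+∞`, i.e. its `ω`-limit set. -/
def clusterSet (u : ℝ → E) : Set E := {p | MapClusterPt p atTop u}

theorem exists_seq_of_mem_clusterSet {u : ℝ → E} {p : E} (hp : p ∈ clusterSet u) :
    ∃ t : ℕ → ℝ, (∀ n, 0 < t n) ∧ StrictMono t ∧ Tendsto t atTop atTop ∧
      Tendsto (fun n => u (t n)) atTop (𝓝 p) := by
  obtain ⟨s, hu, hs⟩ := MapClusterPt.exists_seq_tendsto hp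
  obtain ⟨N, hN⟩ := eventually_atTop.1 (hs.eventually_gt_atTop 0)
  have hs' : Tendsto (fun n => s (n + N)) atTop atTop := hs.comp (tendsto_add_atTop_nat N)
  obtain ⟨φ, hφ, hm⟩ := strictMono_subseq_of_tendsto_atTop hs'
  exact ⟨_, fun n => hN _ (Nat.le_add_left _ _), hm, hs'.comp hφ.tendsto_atTop,
    (hu.comp (tendsto_add_atTop_nat N)).comp hφ.tendsto_atTop⟩

theorem mem_clusterSet_of_tendsto {u : ℝ → E} {p : E} {t : ℕ → ℝ} (ht : Tendsto t atTop atTop)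
    (hp : Tendsto (fun n => u (t n)) atTop (𝓝 p)) : p ∈ clusterSet u :=
  MapClusterPt.of_comp ht hp.mapClusterPt

theorem clusterSet_eq_iInter (u : ℝ → E) :
    clusterSet u = ⋂ T : Ici (0 : ℝ), closure (u '' Ici T) := by
  ext p
  simp only [clusterSet, mem_ofPred_eq, mem_iInter, mapClusterPt_iff_frequently]
  constructor
  · rintro h ⟨T, -⟩
    refine mem_closure_iff_nhds.2 fun s hs => ?_
    obtain ⟨a, ha, has⟩ := frequently_atTop.1 (h s hs) T
    exact ⟨u a, has, a, ha, rfl⟩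
  · intro h s hs
    refine frequently_atTop.2 fun a => ?_
    obtain ⟨_, hy, b, hb, rfl⟩ := mem_closure_iff_nhds.1 (h ⟨max a 0, mem_Ici.2 (le_max_right _ _)⟩) s hs
    exact ⟨b, (le_max_left _ _).trans hb, hy⟩

theorem directed_closure_tail (u : ℝ → E) :
    Directed (· ⊇ ·) fun T : Ici (0 : ℝ) => closure (u '' Ici T) := fun S T =>
  ⟨⟨max S T, mem_Ici.2 (S.2.trans (le_max_left _ _))⟩,
    closure_mono (image_mono (Ici_subset_Ici.2 (le_max_left _ _))),
    closure_mono (image_mono (Ici_subset_Ici.2 (le_max_right _ _)))⟩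

variable [ProperSpace E] {u : ℝ → E} {R : ℝ}

theorem isCompact_closure_tail (hR : ∀ t, 0 ≤ t → ‖u t‖ ≤ R) (T : Ici (0 : ℝ)) :
    IsCompact (closure (u '' Ici T)) := by
  refine (isCompact_closedBall (0 : E) R).of_isClosed_subset isClosed_closure
    (closure_minimal ?_ Metric.isClosed_closedBall)
  rintro _ ⟨t, ht, rfl⟩
  exact mem_closedBall_zero_iff.2 (hR t (T.2.trans ht))

theorem isCompact_clusterSet (hR : ∀ t, 0 ≤ t → ‖u t‖ ≤ R) : IsCompact (clusterSet u) := by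
  rw [clusterSet_eq_iInter]
  exact (isCompact_closure_tail hR ⟨0, self_mem_Ici⟩).of_isClosed_subset
    (isClosed_iInter fun _ => isClosed_closure) (iInter_subset _ _)

theorem clusterSet_nonempty (hR : ∀ t, 0 ≤ t → ‖u t‖ ≤ R) : (clusterSet u).Nonempty := by
  obtain ⟨p, -, hp⟩ := (isCompact_closedBall (0 : E) R).exists_mapClusterPt (u := u) (f := atTop)
    (le_principal_iff.2 (mem_map.2 ((eventually_ge_atTop 0).mono fun t ht =>
      mem_closedBall_zero_iff.2 (hR t ht))))
  exact ⟨p, hp⟩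

/-- The cluster set is a decreasing intersection of the compact connected closures of the tails:
two open sets separating it would already separate a tail. -/
theorem isConnected_clusterSet (hR : ∀ t, 0 ≤ t → ‖u t‖ ≤ R) (hu : ContinuousOn u (Ici 0)) :
    IsConnected (clusterSet u) := by
  refine ⟨clusterSet_nonempty hR, ?_⟩
  have hA := isCompact_clusterSet hR
  rw [isPreconnected_iff_subset_of_fully_disjoint_closed hA.isClosed]
  intro a b ha hb hab hd
  obtain ⟨U, V, hU, hV, haU, hbV, hUV⟩ := SeparatedNhds.of_isCompact_isCompact
    (hA.inter_right ha) (hA.inter_right hb)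
    (hd.mono inter_subset_right inter_subset_right)
  have hsub : ⋂ T : Ici (0 : ℝ), closure (u '' Ici T) ⊆ U ∪ V := by
    rw [← clusterSet_eq_iInter]
    intro x hx
    exact (hab hx).imp (fun h => haU ⟨hx, h⟩) fun h => hbV ⟨hx, h⟩
  obtain ⟨T, hT⟩ := exists_subset_nhds_of_isCompact' (directed_closure_tail u)
    (isCompact_closure_tail hR) (fun _ => isClosed_closure)
    (fun x hx => (hU.union hV).mem_nhds (hsub hx))
  have hconn : IsPreconnected (closure (u '' Ici T.1)) :=
    ((isPreconnected_Ici (a := T.1)).image u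
      (hu.mono (Ici_subset_Ici.2 T.2))).closure
  have hle : clusterSet u ⊆ closure (u '' Ici T.1) := by
    rw [clusterSet_eq_iInter]; exact iInter_subset _ T
  rcases hconn.subset_or_subset hU hV hUV hT with h | h
  · left
    intro x hx
    refine (hab hx).resolve_right fun hxb => ?_
    exact disjoint_left.1 hUV (h (hle hx)) (hbV ⟨hx, hxb⟩)
  · right
    intro x hx
    refine (hab hx).resolve_left fun hxa => ?_
    exact disjoint_left.1 hUV (haU ⟨hx, hxa⟩) (h (hle hx))

end ClusterPoints

/-! ### Asymptotically autonomous differential equations -/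

section Asymptotic

variable {E : Type*} [NormedAddCommGroup E] [NormedSpace ℝ E]

theorem hasDerivAt_of_eq_sub_integral [CompleteSpace E] {m f : ℝ → E} (hf : ContinuousOn f (Ici 0))
    (hm : ∀ t, 0 < t → m t = m 0 - ∫ τ in (0 : ℝ)..t, f τ) {t : ℝ} (ht : 0 < t) :
    HasDerivAt m (-f t) t := by
  have hsub : uIcc 0 t ⊆ Ici 0 := by rw [uIcc_of_le ht.le]; exact Icc_subset_Ici_self
  have hd := intervalIntegral.integral_hasDerivAt_right ((hf.mono hsub).intervalIntegrable)
    ((hf.mono Ioi_subset_Ici_self).stronglyMeasurableAtFilter isOpen_Ioi t ht)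
    (hf.continuousAt (Ici_mem_nhds ht))
  refine (hd.const_sub (m 0)).congr_of_eventuallyEq ?_
  filter_upwards [Ioi_mem_nhds ht] with τ hτ using hm τ hτ

/-- Solutions `w ∈ C¹((0, ∞)) ∩ C([0, ∞))` of the autonomous equation `ẇ = g(w)`. -/
def IsForwardSolution (g : E → E) (w : ℝ → E) : Prop :=
  ContinuousOn w (Ici 0) ∧ ∀ t, 0 < t → HasDerivAt w (g (w t)) t

/-- Bounded solutions of `u̇ = g(u) + e(t)` whose forcing `e` vanishes as `t → ∞`. -/
structure IsAsymptoticSolution (g : E → E) (e u : ℝ → E) : Prop where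
  continuousOn : ContinuousOn u (Ici 0)
  bounded : ∃ R, ∀ t, 0 ≤ t → ‖u t‖ ≤ R
  hasDerivAt : ∀ t, 0 < t → HasDerivAt u (g (u t) + e t) t
  continuousOn_error : ContinuousOn e (Ioi 0)
  tendsto_error : Tendsto e atTop (𝓝 0)

theorem IsForwardSolution.hasDerivWithinAt {g : E → E} (hg : Continuous g) {w : ℝ → E}
    (hw : IsForwardSolution g w) {t : ℝ} (ht : 0 ≤ t) :
    HasDerivWithinAt w (g (w t)) (Ici t) t := by
  rcases ht.eq_or_lt with rfl | ht
  · have h0 : ContinuousWithinAt w (Ioi 0) 0 := (hw.1 0 self_mem_Ici).mono Ioi_subset_Ici_self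
    refine hasDerivWithinAt_Ici_of_tendsto_deriv (s := Ioi 0)
      (fun x hx => (hw.2 x hx).differentiableAt.differentiableWithinAt) h0
      self_mem_nhdsWithin ?_
    refine (hg.continuousAt.tendsto.comp h0).congr' ?_
    filter_upwards [self_mem_nhdsWithin] with x hx
    exact (hw.2 x hx).deriv.symm
  · exact (hw.2 t ht).hasDerivWithinAt

/-- Grönwall's inequality for two `ε`-approximate solutions in a ball, in the form that is linear
in `ε`. -/
theorem dist_le_mul_of_approx {g : E → E} {K : NNReal} {R : ℝ}
    (hK : LipschitzOnWith K g (Metric.closedBall 0 R)) {T : ℝ} (hT : 0 ≤ T) :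
    ∃ c : ℝ, 0 < c ∧ ∀ ε : ℝ, ∀ f₁ f₁' f₂ f₂' : ℝ → E,
      ContinuousOn f₁ (Icc 0 T) → ContinuousOn f₂ (Icc 0 T) →
      (∀ s ∈ Ico 0 T, HasDerivWithinAt f₁ (f₁' s) (Ici s) s) →
      (∀ s ∈ Ico 0 T, HasDerivWithinAt f₂ (f₂' s) (Ici s) s) →
      (∀ s ∈ Ico 0 T, dist (f₁' s) (g (f₁ s)) ≤ ε) →
      (∀ s ∈ Ico 0 T, dist (f₂' s) (g (f₂ s)) ≤ ε) →
      (∀ s ∈ Ico 0 T, ‖f₁ s‖ ≤ R) → (∀ s ∈ Ico 0 T, ‖f₂ s‖ ≤ R) →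
      dist (f₁ 0) (f₂ 0) ≤ ε → dist (f₁ T) (f₂ T) ≤ ε * c := by
  have hK1 : ((K + 1 : NNReal) : ℝ) ≠ 0 := by positivity
  have hexp : 1 ≤ Real.exp ((K + 1 : NNReal) * T) := Real.one_le_exp (by positivity)
  refine ⟨Real.exp ((K + 1 : NNReal) * T)
    + 2 / (K + 1 : NNReal) * (Real.exp ((K + 1 : NNReal) * T) - 1), ?_, ?_⟩
  · have : 0 ≤ 2 / ((K + 1 : NNReal) : ℝ) * (Real.exp ((K + 1 : NNReal) * T) - 1) :=
      mul_nonneg (by positivity) (by linarith)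
    linarith
  · intro ε f₁ f₁' f₂ f₂' hc₁ hc₂ hd₁ hd₂ hb₁ hb₂ hR₁ hR₂ h0
    have h := dist_le_of_approx_trajectories_ODE_of_mem (v := fun _ => g)
      (s := fun _ => Metric.closedBall 0 R) (K := K + 1)
      (fun _ _ => hK.weaken le_self_add) hc₁ hd₁ hb₁
      (fun s hs => mem_closedBall_zero_iff.2 (hR₁ s hs)) hc₂ hd₂ hb₂
      (fun s hs => mem_closedBall_zero_iff.2 (hR₂ s hs)) h0 T (right_mem_Icc.2 hT)
    rw [gronwallBound_of_K_ne_0 hK1, sub_zero] at h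
    refine h.trans_eq ?_
    field_simp
    ring

namespace IsAsymptoticSolution

variable {g : E → E} {e u : ℝ → E} (hu : IsAsymptoticSolution g e u)
include hu

theorem continuousOn_shift {a : ℝ} (ha : 0 ≤ a) : ContinuousOn (fun s => u (a + s)) (Ici 0) :=
  hu.continuousOn.comp (by fun_prop) fun s hs => add_nonneg ha hs

theorem hasDerivAt_shift {a : ℝ} (ha : 0 < a) {s : ℝ} (hs : 0 ≤ s) :
    HasDerivAt (fun s => u (a + s)) (g (u (a + s)) + e (a + s)) s :=
  (hu.hasDerivAt (a + s) (by positivity)).comp_const_add a s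

theorem eventually_shift_error {t : ℕ → ℝ} (ht : Tendsto t atTop atTop) {ε : ℝ} (hε : 0 < ε) :
    ∀ᶠ n in atTop, 0 < t n ∧ ∀ s, 0 ≤ s → ‖e (t n + s)‖ ≤ ε := by
  obtain ⟨T, hT⟩ := eventually_atTop.1
    ((tendsto_zero_iff_norm_tendsto_zero.1 hu.tendsto_error).eventually_le_const hε)
  filter_upwards [ht.eventually_gt_atTop 0, ht.eventually_ge_atTop T] with n h0 h1
  exact ⟨h0, fun s hs => hT _ (by linarith)⟩

/-- The translates of `u` follow the solution of the autonomous equation that starts at the limit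
of their initial values. -/
theorem tendsto_shift (hgc : Continuous g)
    (hg : ∀ R, ∃ K, LipschitzOnWith K g (Metric.closedBall 0 R))
    {t : ℕ → ℝ} (ht : Tendsto t atTop atTop) {w : ℝ → E} (hw : IsForwardSolution g w)
    (h0 : Tendsto (fun n => u (t n)) atTop (𝓝 (w 0))) {T : ℝ} (hT : 0 ≤ T) :
    Tendsto (fun n => u (t n + T)) atTop (𝓝 (w T)) := by
  obtain ⟨R₁, hR₁⟩ := hu.bounded
  have hwc : ContinuousOn w (Icc 0 T) := hw.1.mono Icc_subset_Ici_self
  obtain ⟨R₂, hR₂⟩ := isCompact_Icc.exists_bound_of_continuousOn hwc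
  obtain ⟨K, hK⟩ := hg (max R₁ R₂)
  obtain ⟨c, hc, hmain⟩ := dist_le_mul_of_approx hK hT
  rw [Metric.tendsto_nhds]
  intro η hη
  have hε : 0 < η / (2 * c) := by positivity
  filter_upwards [hu.eventually_shift_error ht hε,
    (Metric.tendsto_nhds.1 h0) _ hε] with n hn hn0
  have := hmain (η / (2 * c)) (fun s => u (t n + s)) (fun s => g (u (t n + s)) + e (t n + s))
    w (fun s => g (w s)) ((hu.continuousOn_shift hn.1.le).mono Icc_subset_Ici_self) hwc
    (fun s hs => (hu.hasDerivAt_shift hn.1 hs.1).hasDerivWithinAt)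
    (fun s hs => hw.hasDerivWithinAt hgc hs.1)
    (fun s hs => by simpa [dist_eq_norm] using hn.2 s hs.1) (fun s _ => by simpa using hε.le)
    (fun s hs => (hR₁ _ (add_nonneg hn.1.le hs.1)).trans (le_max_left _ _))
    (fun s hs => (hR₂ _ ⟨hs.1, hs.2.le⟩).trans (le_max_right _ _)) (by simpa using hn0.le)
  refine this.trans_lt ?_
  rw [show η / (2 * c) * c = η / 2 by field_simp]
  linarith

theorem cauchySeq_shift (hg : ∀ R, ∃ K, LipschitzOnWith K g (Metric.closedBall 0 R))
    {t : ℕ → ℝ} (ht : Tendsto t atTop atTop) {p : E}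
    (h0 : Tendsto (fun n => u (t n)) atTop (𝓝 p)) {T : ℝ} (hT : 0 ≤ T) :
    CauchySeq fun n => u (t n + T) := by
  obtain ⟨R, hR⟩ := hu.bounded
  obtain ⟨K, hK⟩ := hg R
  obtain ⟨c, hc, hmain⟩ := dist_le_mul_of_approx hK hT
  rw [Metric.cauchySeq_iff]
  intro η hη
  have hε : 0 < η / (2 * c) := by positivity
  obtain ⟨N₁, hN₁⟩ := eventually_atTop.1 (hu.eventually_shift_error ht hε)
  obtain ⟨N₂, hN₂⟩ := Metric.cauchySeq_iff.1 h0.cauchySeq _ hε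
  refine ⟨max N₁ N₂, fun m hm n hn => ?_⟩
  have hm1 := hN₁ m ((le_max_left _ _).trans hm)
  have hn1 := hN₁ n ((le_max_left _ _).trans hn)
  have h00 := hN₂ m ((le_max_right _ _).trans hm) n ((le_max_right _ _).trans hn)
  have := hmain (η / (2 * c)) (fun s => u (t m + s)) (fun s => g (u (t m + s)) + e (t m + s))
    (fun s => u (t n + s)) (fun s => g (u (t n + s)) + e (t n + s))
    ((hu.continuousOn_shift hm1.1.le).mono Icc_subset_Ici_self)
    ((hu.continuousOn_shift hn1.1.le).mono Icc_subset_Ici_self)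
    (fun s hs => (hu.hasDerivAt_shift hm1.1 hs.1).hasDerivWithinAt)
    (fun s hs => (hu.hasDerivAt_shift hn1.1 hs.1).hasDerivWithinAt)
    (fun s hs => by simpa [dist_eq_norm] using hm1.2 s hs.1)
    (fun s hs => by simpa [dist_eq_norm] using hn1.2 s hs.1)
    (fun s hs => hR _ (add_nonneg hm1.1.le hs.1))
    (fun s hs => hR _ (add_nonneg hn1.1.le hs.1)) (by simpa using h00.le)
  refine this.trans_lt ?_
  rw [show η / (2 * c) * c = η / 2 by field_simp]
  linarith

/-- The cluster set is positively invariant. -/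
theorem mem_clusterSet_of_forwardSolution (hgc : Continuous g)
    (hg : ∀ R, ∃ K, LipschitzOnWith K g (Metric.closedBall 0 R)) {w : ℝ → E}
    (hw : IsForwardSolution g w) (h0 : w 0 ∈ clusterSet u) {T : ℝ} (hT : 0 ≤ T) :
    w T ∈ clusterSet u := by
  obtain ⟨t, -, -, ht, h⟩ := exists_seq_of_mem_clusterSet h0
  exact mem_clusterSet_of_tendsto (tendsto_atTop_add_const_right _ T ht)
    (hu.tendsto_shift hgc hg ht hw h hT)

variable [FiniteDimensional ℝ E]

/-- From each cluster point of an asymptotic solution there starts a global solution of the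
autonomous equation, namely a limit of translates. -/
theorem exists_forwardSolution (hgc : Continuous g)
    (hg : ∀ R, ∃ K, LipschitzOnWith K g (Metric.closedBall 0 R))
    {p : E} (hp : p ∈ clusterSet u) : ∃ w, IsForwardSolution g w ∧ w 0 = p := by
  have : ProperSpace E := FiniteDimensional.proper ℝ E
  obtain ⟨t, htpos, -, ht, h0⟩ := exists_seq_of_mem_clusterSet hp
  have hex : ∀ s, ∃ q, 0 ≤ s → Tendsto (fun n => u (t n + s)) atTop (𝓝 q) := by
    intro s
    by_cases hs : 0 ≤ s
    · obtain ⟨q, hq⟩ := cauchySeq_tendsto_of_complete (hu.cauchySeq_shift hg ht h0 hs)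
      exact ⟨q, fun _ => hq⟩
    · exact ⟨0, fun h => absurd h hs⟩
  choose w hw using hex
  have hw0 : w 0 = p := tendsto_nhds_unique (by simpa using hw 0 le_rfl) h0
  obtain ⟨R, hR⟩ := hu.bounded
  obtain ⟨M, hM⟩ := (isCompact_closedBall (0 : E) R).exists_bound_of_continuousOn hgc.continuousOn
  have hbound : ∀ᶠ n in atTop, ∀ s, 0 ≤ s → ‖g (u (t n + s)) + e (t n + s)‖ ≤ M + 1 := by
    filter_upwards [hu.eventually_shift_error ht one_pos] with n hn s hs
    exact (norm_add_le _ _).trans (add_le_add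
      (hM _ (mem_closedBall_zero_iff.2 (hR _ (add_nonneg hn.1.le hs)))) (hn.2 s hs))
  have hlip : ∀ x ∈ Ici (0 : ℝ), ∀ y ∈ Ici (0 : ℝ), ‖w y - w x‖ ≤ (M + 1) * ‖y - x‖ := by
    intro x hx y hy
    refine le_of_tendsto ((hw y hy).sub (hw x hx)).norm ?_
    filter_upwards [hbound] with n hn
    exact (convex_Ici (0 : ℝ)).norm_image_sub_le_of_norm_hasDerivWithin_le
      (fun s hs => (hu.hasDerivAt_shift (htpos n) hs).hasDerivWithinAt) hn hx hy
  have hwc : ContinuousOn w (Ici 0) := by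
    have hM0 : 0 ≤ M + 1 := by
      have := (norm_nonneg _).trans (hM 0
        (mem_closedBall_zero_iff.2 (by simpa using (norm_nonneg _).trans (hR 0 le_rfl))))
      linarith
    refine (LipschitzOnWith.of_dist_le_mul (K := ⟨M + 1, hM0⟩) fun y hy x hx => ?_).continuousOn
    rw [dist_eq_norm, dist_eq_norm]
    exact hlip x hx y hy
  have hint : ∀ s, 0 ≤ s → w s = p + ∫ τ in (0 : ℝ)..s, g (w τ) := by
    intro s hs
    have hcont : ∀ n, ContinuousOn (fun τ => g (u (t n + τ)) + e (t n + τ)) (Ici 0) := fun n =>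
      (hgc.comp_continuousOn (hu.continuousOn_shift (htpos n).le)).add
        (hu.continuousOn_error.comp (by fun_prop)
          fun τ hτ => add_pos_of_pos_of_nonneg (htpos n) hτ)
    have hsub : uIcc 0 s ⊆ Ici 0 := by rw [uIcc_of_le hs]; exact Icc_subset_Ici_self
    have hftc : ∀ n, ∫ τ in (0 : ℝ)..s, (g (u (t n + τ)) + e (t n + τ))
        = u (t n + s) - u (t n) := by
      intro n
      have := intervalIntegral.integral_eq_sub_of_hasDerivAt (a := 0) (b := s)
        (f := fun τ => u (t n + τ))
        (fun τ hτ => hu.hasDerivAt_shift (htpos n) (hsub hτ))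
        ((hcont n).mono hsub).intervalIntegrable
      simpa using this
    have hlim : Tendsto (fun n => ∫ τ in (0 : ℝ)..s, (g (u (t n + τ)) + e (t n + τ))) atTop
        (𝓝 (∫ τ in (0 : ℝ)..s, g (w τ))) := by
      refine intervalIntegral.tendsto_integral_filter_of_dominated_convergence (fun _ => M + 1)
        (Eventually.of_forall fun n => ?_) ?_ intervalIntegrable_const ?_
      · exact ((hcont n).mono (uIoc_subset_uIcc.trans hsub)).aestronglyMeasurable
          measurableSet_uIoc
      · filter_upwards [hbound] with n hn
        exact Eventually.of_forall fun τ hτ => hn τ (hsub (uIoc_subset_uIcc hτ))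
      · refine Eventually.of_forall fun τ hτ => ?_
        have hτ0 : 0 ≤ τ := hsub (uIoc_subset_uIcc hτ)
        have he : Tendsto (fun n => e (t n + τ)) atTop (𝓝 0) :=
          hu.tendsto_error.comp (tendsto_atTop_add_const_right _ _ ht)
        simpa using ((hgc.tendsto _).comp (hw τ hτ0)).add he
    have h2 := (hw s hs).sub h0
    simp only [hftc] at hlim
    rw [tendsto_nhds_unique hlim h2, add_sub_cancel]
  refine ⟨w, ⟨hwc, fun s hs => ?_⟩, hw0⟩
  have hgw : ContinuousOn (fun τ => g (w τ)) (Ici 0) := hgc.comp_continuousOn hwc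
  have hsub : uIcc 0 s ⊆ Ici 0 := by rw [uIcc_of_le hs.le]; exact Icc_subset_Ici_self
  have hd := intervalIntegral.integral_hasDerivAt_right ((hgw.mono hsub).intervalIntegrable)
    ((hgw.mono Ioi_subset_Ici_self).stronglyMeasurableAtFilter isOpen_Ioi s hs)
    (hgw.continuousAt (Ici_mem_nhds hs))
  refine (hd.const_add p).congr_of_eventuallyEq ?_
  filter_upwards [Ioi_mem_nhds hs] with τ hτ using hint τ (le_of_lt hτ)

/-- The cluster set is negatively invariant: to reach `q = lim u(tₙ)` at time `T`, start at a
cluster point of `u(tₙ - T)`. -/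
theorem exists_forwardSolution_of_mem_clusterSet (hgc : Continuous g)
    (hg : ∀ R, ∃ K, LipschitzOnWith K g (Metric.closedBall 0 R)) {q : E}
    (hq : q ∈ clusterSet u) {T : ℝ} (hT : 0 ≤ T) :
    ∃ w, IsForwardSolution g w ∧ w 0 ∈ clusterSet u ∧ w T = q := by
  have : ProperSpace E := FiniteDimensional.proper ℝ E
  obtain ⟨t, -, -, ht, h⟩ := exists_seq_of_mem_clusterSet hq
  obtain ⟨R, hR⟩ := hu.bounded
  have ht' : Tendsto (fun n => t n - T) atTop atTop :=
    tendsto_atTop_add_const_right _ (-T) ht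
  obtain ⟨p, -, φ, hφ, hp⟩ := (isCompact_closedBall (0 : E) R).isSeqCompact.subseq_of_frequently_in
    (x := fun n => u (t n - T)) ((ht'.eventually_ge_atTop 0).mono fun n hn =>
      mem_closedBall_zero_iff.2 (hR _ hn)).frequently
  have htφ : Tendsto (fun n => t (φ n) - T) atTop atTop := ht'.comp hφ.tendsto_atTop
  have hpc : p ∈ clusterSet u := mem_clusterSet_of_tendsto htφ hp
  obtain ⟨w, hw, rfl⟩ := hu.exists_forwardSolution hgc hg hpc
  refine ⟨w, hw, hpc, tendsto_nhds_unique (hu.tendsto_shift hgc hg htφ hw hp hT) ?_⟩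
  simpa [Function.comp_def] using h.comp hφ.tendsto_atTop

end IsAsymptoticSolution

end Asymptotic

/-! ### Vector algebra -/

theorem inner_eq_sum (a b : E3) : inner ℝ a b = a 0 * b 0 + a 1 * b 1 + a 2 * b 2 := by
  simp [PiLp.inner_apply, Fin.sum_univ_three, mul_comm]

theorem cross_apply_zero (a b : E3) : cross a b 0 = a 1 * b 2 - a 2 * b 1 := by
  simp [cross, cross_apply]

theorem cross_apply_one (a b : E3) : cross a b 1 = a 2 * b 0 - a 0 * b 2 := by
  simp [cross, cross_apply]

theorem cross_apply_two (a b : E3) : cross a b 2 = a 0 * b 1 - a 1 * b 0 := by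
  simp [cross, cross_apply]

/-- Lagrange's identity. -/
theorem norm_cross_sq (a b : E3) :
    ‖cross a b‖ ^ 2 = ‖a‖ ^ 2 * ‖b‖ ^ 2 - inner ℝ a b ^ 2 := by
  simp only [← real_inner_self_eq_norm_sq, inner_eq_sum, cross_apply_zero, cross_apply_one,
    cross_apply_two]
  ring

theorem norm_cross_le (a b : E3) : ‖cross a b‖ ≤ ‖a‖ * ‖b‖ := by
  refine le_of_sq_le_sq ?_ (by positivity)
  rw [norm_cross_sq]
  nlinarith [sq_nonneg (inner ℝ a b : ℝ)]

theorem inner_cross_cyclic (a b c : E3) : inner ℝ a (cross b c) = inner ℝ (cross a b) c := by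
  simp only [inner_eq_sum, cross_apply_zero, cross_apply_one, cross_apply_two]
  ring

theorem inner_self_cross (a b : E3) : inner ℝ a (cross a b) = 0 := by
  simp only [inner_eq_sum, cross_apply_zero, cross_apply_one, cross_apply_two]
  ring

/-- The cross product as a continuous bilinear map. -/
noncomputable def crossCLM : E3 →L[ℝ] E3 →L[ℝ] E3 :=
  LinearMap.mkContinuous₂
    (LinearMap.mk₂ ℝ cross (fun a b c => by simp [cross]) (fun r a b => by simp [cross])
      (fun a b c => by simp [cross]) (fun r a b => by simp [cross])) 1
    fun a b => by rw [one_mul]; exact norm_cross_le a b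

theorem crossCLM_apply (a b : E3) : crossCLM a b = cross a b := rfl

theorem continuous_cross : Continuous fun p : E3 × E3 => cross p.1 p.2 :=
  crossCLM.continuous₂

theorem _root_.ContinuousOn.cross {f g : ℝ → E3} {s : Set ℝ} (hf : ContinuousOn f s)
    (hg : ContinuousOn g s) : ContinuousOn (fun t => LiquidBody.cross (f t) (g t)) s :=
  continuous_cross.comp_continuousOn (hf.prodMk hg)

/-- `‖cross b x‖ = 0` is the equality case of the Cauchy-Schwarz inequality. -/
theorem mem_span_of_cross_eq_zero {b x : E3} (hb : b ≠ 0) (h : cross b x = 0) :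
    x ∈ Submodule.span ℝ {b} := by
  have hb2 : ‖b‖ ^ 2 ≠ 0 := by positivity
  have h1 : ‖b‖ ^ 2 * ‖x‖ ^ 2 - inner ℝ b x ^ 2 = 0 := by rw [← norm_cross_sq, h]; simp
  have h2 : ‖‖b‖ ^ 2 • x - (inner ℝ b x : ℝ) • b‖ ^ 2 = 0 := by
    rw [norm_sub_sq_real, norm_smul, norm_smul, real_inner_smul_left, real_inner_smul_right,
      real_inner_comm b x, mul_pow, mul_pow, Real.norm_eq_abs, Real.norm_eq_abs, sq_abs, sq_abs]
    linear_combination ‖b‖ ^ 2 * h1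
  have h3 : ‖b‖ ^ 2 • x = (inner ℝ b x : ℝ) • b :=
    sub_eq_zero.1 (norm_eq_zero.1 (pow_eq_zero_iff two_ne_zero |>.1 h2))
  refine Submodule.mem_span_singleton.2 ⟨(‖b‖ ^ 2)⁻¹ * inner ℝ b x, ?_⟩
  rw [mul_smul, ← h3, smul_smul, inv_mul_cancel₀ hb2, one_smul]

/-- The action of a matrix as a continuous linear map. -/
noncomputable def actCLM (M : Matrix (Fin 3) (Fin 3) ℝ) : E3 →L[ℝ] E3 :=
  LinearMap.toContinuousLinearMap (Matrix.toEuclideanLin M)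

theorem actCLM_apply (M : Matrix (Fin 3) (Fin 3) ℝ) (w : E3) : actCLM M w = act M w := rfl

theorem continuous_act (M : Matrix (Fin 3) (Fin 3) ℝ) : Continuous (act M) :=
  (actCLM M).continuous

theorem _root_.ContinuousOn.act {f : ℝ → E3} {s : Set ℝ} (hf : ContinuousOn f s)
    (M : Matrix (Fin 3) (Fin 3) ℝ) : ContinuousOn (fun t => LiquidBody.act M (f t)) s :=
  (continuous_act M).comp_continuousOn hf

theorem act_apply (M : Matrix (Fin 3) (Fin 3) ℝ) (w : E3) (i : Fin 3) :
    act M w i = ∑ j, M i j * w j := by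
  simp [act, Matrix.mulVec, dotProduct]

theorem act_inv_act {M : Matrix (Fin 3) (Fin 3) ℝ} (hM : M.det ≠ 0) (w : E3) :
    act M⁻¹ (act M w) = w := by
  ext i
  simp [act, Matrix.nonsing_inv_mul M (isUnit_iff_ne_zero.2 hM)]

theorem act_act_inv {M : Matrix (Fin 3) (Fin 3) ℝ} (hM : M.det ≠ 0) (w : E3) :
    act M (act M⁻¹ w) = w := by
  ext i
  simp [act, Matrix.mul_nonsing_inv M (isUnit_iff_ne_zero.2 hM)]

theorem det_ne_zero_of_inner_pos {M : Matrix (Fin 3) (Fin 3) ℝ}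
    (h : ∀ b : E3, b ≠ 0 → 0 < inner ℝ b (act M b)) : M.det ≠ 0 := by
  intro h0
  obtain ⟨w, hw, hMw⟩ := Matrix.exists_mulVec_eq_zero_iff.2 h0
  have h1 := h (WithLp.toLp 2 w) (by simpa using hw)
  simp [act, hMw] at h1

/-- A positive quadratic form on `ℝ³` is coercive, by compactness of the sphere. -/
theorem exists_coercive_of_inner_pos {M : Matrix (Fin 3) (Fin 3) ℝ}
    (h : ∀ b : E3, b ≠ 0 → 0 < inner ℝ b (act M b)) :
    ∃ c : ℝ, 0 < c ∧ ∀ b : E3, c * ‖b‖ ^ 2 ≤ inner ℝ b (act M b) := by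
  have hc : Continuous fun b : E3 => inner ℝ b (act M b) :=
    continuous_id.inner (continuous_act M)
  obtain ⟨b₀, hb₀, hmin⟩ := (isCompact_sphere (0 : E3) 1).exists_isMinOn
    (NormedSpace.sphere_nonempty.2 zero_le_one) hc.continuousOn
  have hb₀' : b₀ ≠ 0 := by
    rintro rfl
    simp at hb₀
  refine ⟨_, h b₀ hb₀', fun b => ?_⟩
  rcases eq_or_ne b 0 with rfl | hb
  · simp
  have hn : ‖b‖ ≠ 0 := norm_ne_zero_iff.2 hb
  have h1 := hmin (show ‖b‖⁻¹ • b ∈ Metric.sphere (0 : E3) 1 by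
    simp [norm_smul, hn])
  simp only [mem_ofPred_eq, ← actCLM_apply, map_smul, real_inner_smul_left,
    real_inner_smul_right] at h1
  rw [← actCLM_apply M b, ← actCLM_apply M b₀]
  calc _ ≤ ‖b‖⁻¹ * (‖b‖⁻¹ * inner ℝ b (actCLM M b)) * ‖b‖ ^ 2 := by gcongr
    _ = _ := by field_simp

/-! ### Inertia tensors -/

theorem integrable_sq_norm_of_bounded {m : Measure E3} [IsFiniteMeasure m] {K : Set E3}
    (hK : Bornology.IsBounded K) (hm : ∀ᵐ x ∂m, x ∈ K) : Integrable (fun x => ‖x‖ ^ 2) m := by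
  obtain ⟨B, hB⟩ := hK.exists_norm_le
  refine Integrable.of_bound (by fun_prop) (B ^ 2) ?_
  filter_upwards [hm] with x hx
  rw [norm_pow, norm_norm]
  gcongr
  exact hB x hx

theorem inner_act_inertiaTensor {m : Measure E3} (hm : Integrable (fun x => ‖x‖ ^ 2) m)
    (w u : E3) : inner ℝ w (act (inertiaTensor m) u)
      = ∫ x, (‖x‖ ^ 2 * inner ℝ w u - inner ℝ x w * inner ℝ x u) ∂m := by
  have hint : ∀ i j : Fin 3, Integrable
      (fun x : E3 => ‖x‖ ^ 2 * (if i = j then 1 else 0) - x i * x j) m := by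
    intro i j
    refine (hm.mul_const _).sub (hm.mono' (by fun_prop) (Eventually.of_forall fun x => ?_))
    rw [norm_mul, sq]
    gcongr <;> exact PiLp.norm_apply_le x _
  have hsum : ∀ x : E3, ‖x‖ ^ 2 * inner ℝ w u - inner ℝ x w * inner ℝ x u
      = ∑ i, ∑ j, (‖x‖ ^ 2 * (if i = j then 1 else 0) - x i * x j) * (w i * u j) := by
    intro x
    simp only [inner_eq_sum, Fin.sum_univ_three]
    simp
    ring
  simp only [hsum]
  rw [integral_finsetSum _ fun i _ => integrable_finsetSum _ fun j _ => (hint i j).mul_const _]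
  simp only [integral_finsetSum _ fun j _ => (hint _ j).mul_const _, integral_mul_const]
  rw [inner_eq_sum]
  simp only [act_apply, Fin.sum_univ_three, inertiaTensor, Matrix.of_apply]
  ring

theorem inner_act_inertiaTensor_self {m : Measure E3} (hm : Integrable (fun x => ‖x‖ ^ 2) m)
    (b : E3) : inner ℝ b (act (inertiaTensor m) b) = ∫ x, ‖cross b x‖ ^ 2 ∂m := by
  rw [inner_act_inertiaTensor hm]
  refine integral_congr_ae (Eventually.of_forall fun x => ?_)
  simp only [norm_cross_sq, real_inner_self_eq_norm_sq, real_inner_comm b x]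
  ring

theorem inner_act_inertiaTensor_comm {m : Measure E3} (hm : Integrable (fun x => ‖x‖ ^ 2) m)
    (w u : E3) : inner ℝ w (act (inertiaTensor m) u) = inner ℝ u (act (inertiaTensor m) w) := by
  rw [inner_act_inertiaTensor hm, inner_act_inertiaTensor hm]
  simp only [real_inner_comm u w, mul_comm (inner ℝ _ w)]

theorem integrable_sq_norm_cross {m : Measure E3} (hm : Integrable (fun x => ‖x‖ ^ 2) m)
    (b : E3) : Integrable (fun x => ‖cross b x‖ ^ 2) m := by
  refine (hm.const_mul (‖b‖ ^ 2)).mono'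
    (((crossCLM b).continuous.norm.pow 2).aestronglyMeasurable) (Eventually.of_forall fun x => ?_)
  rw [norm_pow, norm_norm, ← mul_pow]
  gcongr
  exact norm_cross_le b x

/-! ### The angular momentum of the liquid -/

section Moment

variable {C : Set E3}

theorem isFiniteMeasure_restrict (hC : Bornology.IsBounded C) :
    IsFiniteMeasure (volume.restrict C) :=
  ⟨by simpa using hC.measure_lt_top⟩

theorem ae_mem_of_isOpen (hC : IsOpen C) : ∀ᵐ x ∂(volume.restrict C), x ∈ C :=
  ae_restrict_mem hC.measurableSet

theorem memLp_cross (ho : IsOpen C) (hC : Bornology.IsBounded C) (b : E3) :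
    MemLp (cross b) 2 (volume.restrict C) := by
  have := isFiniteMeasure_restrict hC
  obtain ⟨B, hB⟩ := hC.exists_norm_le
  refine MemLp.of_bound (crossCLM b).continuous.aestronglyMeasurable (‖b‖ * B) ?_
  filter_upwards [ae_mem_of_isOpen ho] with x hx
  exact (norm_cross_le b x).trans (by gcongr; exact hB x hx)

/-- The rotation field `x ↦ b × x` represents the linear functional `u ↦ b · ∫_C x × u`. -/
theorem inner_moment (ho : IsOpen C) (hC : Bornology.IsBounded C) (b : E3) (u : VecL2 C) :
    inner ℝ b (moment u) = inner ℝ ((memLp_cross ho hC b).toLp _) u := by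
  have := isFiniteMeasure_restrict hC
  obtain ⟨B, hB⟩ := hC.exists_norm_le
  have hint : Integrable (fun x => cross x (u x)) (volume.restrict C) := by
    refine (((Lp.memLp u).integrable one_le_two).norm.const_mul B).mono'
      (continuous_cross.comp_aestronglyMeasurable
        (continuous_id.aestronglyMeasurable.prodMk (Lp.aestronglyMeasurable u))) ?_
    filter_upwards [ae_mem_of_isOpen ho] with x hx
    exact (norm_cross_le _ _).trans (by gcongr; exact hB x hx)
  rw [moment, ← integral_inner hint, L2.inner_def]
  refine integral_congr_ae ?_
  filter_upwards [(memLp_cross ho hC b).coeFn_toLp] with x hx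
  rw [hx, inner_cross_cyclic]

theorem norm_toLp_cross_sq (ho : IsOpen C) (hC : Bornology.IsBounded C) (b : E3) :
    ‖(memLp_cross ho hC b).toLp _‖ ^ 2 = ∫ x in C, ‖cross b x‖ ^ 2 := by
  rw [← real_inner_self_eq_norm_sq, L2.inner_def]
  refine integral_congr_ae ?_
  filter_upwards [(memLp_cross ho hC b).coeFn_toLp] with x hx
  rw [hx, real_inner_self_eq_norm_sq]

theorem exists_norm_moment_le (ho : IsOpen C) (hC : Bornology.IsBounded C) :
    ∃ B : ℝ, 0 ≤ B ∧ ∀ u : VecL2 C, ‖moment u‖ ≤ B * ‖u‖ := by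
  have := isFiniteMeasure_restrict hC
  have hsq := integrable_sq_norm_of_bounded hC (ae_mem_of_isOpen ho)
  have hX : ∀ b : E3, ‖(memLp_cross ho hC b).toLp _‖ ≤ ‖b‖ * √(∫ x in C, ‖x‖ ^ 2) := by
    intro b
    refine le_of_sq_le_sq ?_ (by positivity)
    rw [norm_toLp_cross_sq ho hC, mul_pow, Real.sq_sqrt (integral_nonneg fun _ => by positivity),
      ← integral_const_mul]
    refine integral_mono (integrable_sq_norm_cross hsq b) (hsq.const_mul _) fun x => ?_
    simp only [← mul_pow]
    gcongr
    exact norm_cross_le b x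
  refine ⟨√(∫ x in C, ‖x‖ ^ 2), Real.sqrt_nonneg _, fun u => ?_⟩
  have h1 : ‖moment u‖ ^ 2 ≤ ‖moment u‖ * √(∫ x in C, ‖x‖ ^ 2) * ‖u‖ := by
    rw [← real_inner_self_eq_norm_sq, inner_moment ho hC]
    exact (real_inner_le_norm _ _).trans (mul_le_mul_of_nonneg_right (hX _) (norm_nonneg _))
  rcases (norm_nonneg (moment u)).eq_or_lt with h0 | h0
  · rw [← h0]
    exact mul_nonneg (Real.sqrt_nonneg _) (norm_nonneg u)
  · exact le_of_mul_le_mul_left (by rw [← mul_assoc, ← sq]; exact h1) h0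

end Moment

namespace SolidLiquid

variable (S : SolidLiquid)

/-! ### Coercivity of the kinetic energy of the liquid -/

theorem integrable_sq_norm_cavity : Integrable (fun x => ‖x‖ ^ 2) (volume.restrict S.cavity) :=
  have := isFiniteMeasure_restrict S.bounded_cavity
  integrable_sq_norm_of_bounded S.bounded_cavity (ae_mem_of_isOpen S.isOpen_cavity)

theorem integrable_sq_norm_bodyMass : Integrable (fun x => ‖x‖ ^ 2) S.bodyMass :=
  have := S.bodyMass_finite
  integrable_sq_norm_of_bounded S.bounded_outer
    ((ae_iff.2 S.bodyMass_carried : ∀ᵐ x ∂S.bodyMass, x ∈ S.outer \ closure S.cavity).mono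
      fun _ hx => hx.1)

theorem integrable_sq_norm_totalMass : Integrable (fun x => ‖x‖ ^ 2) S.totalMass :=
  S.integrable_sq_norm_bodyMass.add_measure
    (S.integrable_sq_norm_cavity.smul_measure ENNReal.ofReal_ne_top)

theorem inner_act_inertia_comm (w u : E3) :
    inner ℝ w (act S.inertia u) = inner ℝ u (act S.inertia w) :=
  inner_act_inertiaTensor_comm S.integrable_sq_norm_totalMass w u

/-- The inertia form splits into the contributions of the body and of the liquid. -/
theorem inner_act_inertia_self (b : E3) : inner ℝ b (act S.inertia b)
    = inner ℝ b (act (inertiaTensor S.bodyMass) b) + S.rho * ∫ x in S.cavity, ‖cross b x‖ ^ 2 := by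
  rw [inertia, inner_act_inertiaTensor_self S.integrable_sq_norm_totalMass,
    inner_act_inertiaTensor_self S.integrable_sq_norm_bodyMass, totalMass,
    integral_add_measure (integrable_sq_norm_cross S.integrable_sq_norm_bodyMass b)
      ((integrable_sq_norm_cross S.integrable_sq_norm_cavity b).smul_measure
        ENNReal.ofReal_ne_top), integral_smul_measure, ENNReal.toReal_ofReal S.rho_pos.le,
    smul_eq_mul]

theorem inner_act_bodyInertia_pos {b : E3} (hb : b ≠ 0) :
    0 < inner ℝ b (act (inertiaTensor S.bodyMass) b) := by
  rw [inner_act_inertiaTensor_self S.integrable_sq_norm_bodyMass,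
    integral_pos_iff_support_of_nonneg (fun _ => by positivity)
      (integrable_sq_norm_cross S.integrable_sq_norm_bodyMass b)]
  refine (pos_iff_ne_zero.2 (S.bodyMass_nondegenerate b)).trans_le (measure_mono fun x hx => ?_)
  rw [Function.mem_support]
  intro h0
  exact hx (mem_span_of_cross_eq_zero hb (norm_eq_zero.1 (pow_eq_zero_iff two_ne_zero |>.1 h0)))

theorem inner_act_bodyInertia_le (b : E3) :
    inner ℝ b (act (inertiaTensor S.bodyMass) b) ≤ inner ℝ b (act S.inertia b) := by
  rw [inner_act_inertia_self]
  exact le_add_of_nonneg_right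
    (mul_nonneg S.rho_pos.le (integral_nonneg fun _ => by positivity))

theorem det_inertia_ne_zero : S.inertia.det ≠ 0 :=
  det_ne_zero_of_inner_pos fun b hb =>
    (S.inner_act_bodyInertia_pos hb).trans_le (S.inner_act_bodyInertia_le b)

theorem exists_inertia_coercive :
    ∃ c : ℝ, 0 < c ∧ ∀ b : E3, c * ‖b‖ ^ 2 ≤ inner ℝ b (act S.inertia b) :=
  exists_coercive_of_inner_pos fun b hb =>
    (S.inner_act_bodyInertia_pos hb).trans_le (S.inner_act_bodyInertia_le b)

/-- The form `ρ‖u‖² - a · I · a`: twice the excess of the kinetic energy of the system over that of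
the rigid rotation with the same angular momentum. -/
noncomputable def liquidEnergy (u : VecL2 S.cavity) : ℝ :=
  S.rho * ‖u‖ ^ 2 - inner ℝ (S.aVec u) (act S.inertia (S.aVec u))

theorem liquidEnergy_le (u : VecL2 S.cavity) : S.liquidEnergy u ≤ S.rho * ‖u‖ ^ 2 := by
  obtain ⟨c, hc, h⟩ := S.exists_inertia_coercive
  have := h (S.aVec u)
  have : 0 ≤ c * ‖S.aVec u‖ ^ 2 := by positivity
  rw [liquidEnergy]
  linarith

/-- The form `ρ‖u‖² - a·I·a` is coercive: with `b = I⁻¹·∫ x × u`, Cauchy-Schwarz bounds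
`b·I·b = ∫ (b × x)·u` by the liquid part of the inertia form, and the body takes a fixed
fraction of the inertia form away from the liquid. -/
theorem exists_liquidEnergy_coercive :
    ∃ δ : ℝ, 0 < δ ∧ ∀ u : VecL2 S.cavity, δ * ‖u‖ ^ 2 ≤ S.liquidEnergy u := by
  obtain ⟨c, hc, hcoer⟩ := exists_coercive_of_inner_pos fun b hb => S.inner_act_bodyInertia_pos hb
  set L : ℝ := ‖actCLM S.inertia‖ + c with hL
  have hL0 : 0 < L := by positivity
  have hcL : c ≤ L := le_add_of_nonneg_left (norm_nonneg _)
  refine ⟨S.rho * (c / L), mul_pos S.rho_pos (by positivity), fun u => ?_⟩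
  set b : E3 := act S.inertia⁻¹ (moment u) with hb
  have hIb : act S.inertia b = moment u := act_act_inv S.det_inertia_ne_zero _
  set s : ℝ := inner ℝ b (act S.inertia b) with hs
  set q : ℝ := ∫ x in S.cavity, ‖cross b x‖ ^ 2 with hq
  have hq0 : 0 ≤ q := integral_nonneg fun _ => by positivity
  have hE : S.liquidEnergy u = S.rho * ‖u‖ ^ 2 - S.rho ^ 2 * s := by
    rw [liquidEnergy, aVec, ← hb, ← actCLM_apply, map_neg, map_smul, inner_neg_neg,
      real_inner_smul_left, real_inner_smul_right, actCLM_apply, ← hs]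
    ring
  have hsplit : s = inner ℝ b (act (inertiaTensor S.bodyMass) b) + S.rho * q :=
    S.inner_act_inertia_self b
  have hsL : s ≤ L * ‖b‖ ^ 2 := by
    calc s ≤ ‖b‖ * ‖actCLM S.inertia b‖ := real_inner_le_norm _ _
      _ ≤ ‖b‖ * (‖actCLM S.inertia‖ * ‖b‖) := by gcongr; exact ContinuousLinearMap.le_opNorm _ _
      _ = ‖actCLM S.inertia‖ * ‖b‖ ^ 2 := by ring
      _ ≤ _ := by gcongr; exact le_add_of_nonneg_right hc.le
  have hbody : c / L * s ≤ inner ℝ b (act (inertiaTensor S.bodyMass) b) := by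
    refine le_trans ?_ (hcoer b)
    rw [div_mul_eq_mul_div, div_le_iff₀ hL0]
    nlinarith
  have hθ : c / L ≤ 1 := (div_le_one hL0).2 hcL
  have hs0 : 0 ≤ s := by
    rw [hsplit]
    have := hcoer b
    have : 0 ≤ c * ‖b‖ ^ 2 := by positivity
    have := mul_nonneg S.rho_pos.le hq0
    linarith
  have hcs : s ^ 2 ≤ q * ‖u‖ ^ 2 := by
    have h1 : s = inner ℝ ((memLp_cross S.isOpen_cavity S.bounded_cavity b).toLp _) u := by
      rw [hs, hIb, inner_moment S.isOpen_cavity S.bounded_cavity]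
    rw [hq, ← norm_toLp_cross_sq S.isOpen_cavity S.bounded_cavity, ← mul_pow]
    refine sq_le_sq' ?_ (h1 ▸ real_inner_le_norm _ _)
    exact (neg_nonpos.2 (by positivity)).trans hs0
  have hfin : S.rho * s ≤ (1 - c / L) * ‖u‖ ^ 2 := by
    rcases hs0.eq_or_lt with h0 | h0
    · rw [← h0, mul_zero]
      exact mul_nonneg (by linarith) (by positivity)
    · refine le_of_mul_le_mul_right ?_ h0
      have h2 : S.rho * q ≤ (1 - c / L) * s := by linarith
      calc S.rho * s * s = S.rho * s ^ 2 := by ring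
        _ ≤ S.rho * (q * ‖u‖ ^ 2) := by gcongr; exact S.rho_pos.le
        _ = S.rho * q * ‖u‖ ^ 2 := by ring
        _ ≤ (1 - c / L) * s * ‖u‖ ^ 2 := by gcongr
        _ = _ := by ring
  rw [hE]
  nlinarith [mul_le_mul_of_nonneg_left hfin S.rho_pos.le]

theorem exists_norm_aVec_le : ∃ B : ℝ, 0 ≤ B ∧ ∀ u : VecL2 S.cavity, ‖S.aVec u‖ ≤ B * ‖u‖ := by
  obtain ⟨B, hB0, hB⟩ := exists_norm_moment_le S.isOpen_cavity S.bounded_cavity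
  refine ⟨S.rho * (‖actCLM S.inertia⁻¹‖ * B),
    mul_nonneg S.rho_pos.le (by positivity), fun u => ?_⟩
  rw [aVec, norm_neg, norm_smul, Real.norm_of_nonneg S.rho_pos.le, mul_assoc, mul_assoc]
  refine mul_le_mul_of_nonneg_left ?_ S.rho_pos.le
  exact ((actCLM S.inertia⁻¹).le_opNorm _).trans (by gcongr; exact hB u)

end SolidLiquid

/-! ### The Poincaré inequality -/

theorem gradField_apply (φ : E3 → E3) (x : E3) (i j : Fin 3) :
    gradField φ x (i, j) = fderiv ℝ φ x (EuclideanSpace.single j 1) i := rfl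

/-- The operator norm is at most the Frobenius norm. -/
theorem norm_fderiv_le_norm_gradField (φ : E3 → E3) (x : E3) :
    ‖fderiv ℝ φ x‖ ≤ ‖gradField φ x‖ := by
  refine ContinuousLinearMap.opNorm_le_bound _ (norm_nonneg _) fun y => ?_
  refine le_of_sq_le_sq ?_ (by positivity)
  have hy : ∀ i, fderiv ℝ φ x y i = ∑ j, gradField φ x (i, j) * y j := by
    intro i
    conv_lhs => rw [← (EuclideanSpace.basisFun (Fin 3) ℝ).sum_repr y]
    simp [gradField_apply, mul_comm]
  rw [mul_pow, EuclideanSpace.real_norm_sq_eq, EuclideanSpace.real_norm_sq_eq (gradField φ x),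
    EuclideanSpace.real_norm_sq_eq y, Fintype.sum_prod_type, Finset.sum_mul]
  refine Finset.sum_le_sum fun i _ => ?_
  rw [hy]
  exact Finset.sum_mul_sq_le_sq_mul_sq _ _ _

variable {C : Set E3}

theorem gradField_add {φ ψ : E3 → E3} (hφ : Differentiable ℝ φ) (hψ : Differentiable ℝ ψ) :
    gradField (φ + ψ) = gradField φ + gradField ψ := by
  ext x ij
  simp [gradField, fderiv_add (hφ x) (hψ x)]

theorem gradField_smul (c : ℝ) (φ : E3 → E3) : gradField (c • φ) = c • gradField φ := by
  ext x ij
  simp [gradField, fderiv_const_smul_field]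

/-- The pairs `(φ, ∇φ)` with `φ ∈ C_c^∞(C)` already form a subspace. -/
theorem span_testPairs (C : Set E3) :
    (Submodule.span ℝ (testPairs C) : Set (WithLp 2 (VecL2 C × TenL2 C))) = testPairs C := by
  refine Subset.antisymm (fun P hP => ?_) Submodule.subset_span
  induction hP using Submodule.span_induction with
  | mem P hP => exact hP
  | zero =>
    refine ⟨0, contDiff_zero_fun, HasCompactSupport.zero, by simp, Lp.coeFn_zero _ _ _, ?_⟩
    refine (Lp.coeFn_zero _ _ _).trans (Eventually.of_forall fun x => ?_)
    ext ij
    simp [gradField]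
  | add P Q _ _ hP hQ =>
    obtain ⟨φ, h1, h2, h3, h4, h5⟩ := hP
    obtain ⟨ψ, k1, k2, k3, k4, k5⟩ := hQ
    refine ⟨φ + ψ, h1.add k1, h2.add k2, (tsupport_add φ ψ).trans (union_subset h3 k3), ?_, ?_⟩
    · exact (Lp.coeFn_add P.fst Q.fst).trans (h4.add k4)
    · rw [gradField_add (h1.differentiable (by simp)) (k1.differentiable (by simp))]
      exact (Lp.coeFn_add P.snd Q.snd).trans (h5.add k5)
  | smul c P _ hP =>
    obtain ⟨φ, h1, h2, h3, h4, h5⟩ := hP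
    refine ⟨c • φ, contDiff_const.smul h1, h2.smul_left (f := fun _ => c), ?_, ?_, ?_⟩
    · exact (tsupport_smul_subset_right (fun _ => c) φ).trans h3
    · exact (Lp.coeFn_smul c P.fst).trans (h4.const_smul c)
    · rw [gradField_smul]
      exact (Lp.coeFn_smul c P.snd).trans (h5.const_smul c)

/-- On test fields the inequality is a case of the Gagliardo-Nirenberg-Sobolev inequality; it
passes to the closure. -/
theorem exists_poincare (hC : Bornology.IsBounded C) :
    ∃ B : ℝ, 0 ≤ B ∧ ∀ P ∈ W012 C, ‖P.fst‖ ≤ B * ‖P.snd‖ := by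
  set K := eLpNormLESNormFDerivOfLeConst E3 (volume : Measure E3) C 2 2
  refine ⟨K, K.2, fun P hP => ?_⟩
  have hcl : IsClosed {P : WithLp 2 (VecL2 C × TenL2 C) | ‖P.fst‖ ≤ K * ‖P.snd‖} :=
    isClosed_le (WithLp.continuous_fst ..).norm
      (continuous_const.mul (WithLp.continuous_snd ..).norm)
  refine closure_minimal (s := testPairs C) ?_ hcl ?_
  · rintro P ⟨φ, h1, h2, h3, h4, h5⟩
    have hsob := eLpNorm_le_eLpNorm_fderiv_of_le (μ := (volume : Measure E3)) (u := φ) (s := C)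
      (p := 2) (q := 2) (h1.of_le (by simp)) ((subset_tsupport φ).trans h3) one_le_two
      (by simp; norm_num) (by simp) hC
    have hsupp : Function.support (gradField φ) ⊆ C := by
      refine Subset.trans (fun x hx => ?_) ((tsupport_fderiv_subset ℝ (f := φ)).trans h3)
      refine subset_tsupport _ fun h0 => hx ?_
      ext ij
      simp [gradField, h0]
    have hfst : eLpNorm P.fst 2 (volume.restrict C) ≤ eLpNorm φ 2 volume :=
      (eLpNorm_congr_ae h4).trans_le (eLpNorm_mono_measure _ Measure.restrict_le_self)
    have hsnd : eLpNorm (fderiv ℝ φ) 2 volume ≤ eLpNorm P.snd 2 (volume.restrict C) := by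
      rw [eLpNorm_congr_ae h5, eLpNorm_restrict_eq_of_support_subset hsupp]
      exact eLpNorm_mono fun x => norm_fderiv_le_norm_gradField φ x
    have hle : eLpNorm P.fst 2 (volume.restrict C)
        ≤ K * eLpNorm P.snd 2 (volume.restrict C) :=
      hfst.trans (hsob.trans (by gcongr; exact hsnd))
    rw [mem_ofPred_eq, Lp.norm_def, Lp.norm_def]
    refine (ENNReal.toReal_mono (ENNReal.mul_ne_top ENNReal.coe_ne_top (Lp.eLpNorm_ne_top _))
      hle).trans_eq ?_
    rw [ENNReal.toReal_mul, ENNReal.coe_toReal]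
  · rw [← span_testPairs]
    exact hP

theorem exists_norm_field_le (hC : Bornology.IsBounded C) :
    ∃ B : ℝ, 0 ≤ B ∧ ∀ u : D012 C, ‖field u‖ ≤ B * ‖grad u‖ := by
  obtain ⟨B, hB, h⟩ := exists_poincare hC
  exact ⟨B, hB, fun u => h _ u.2.1⟩

/-! ### Decay of an almost decreasing integrable quantity -/

/-- A nonnegative function that is dominated by an integrable one, and whose increase over
intervals of length at most one is controlled by the integral of the latter, tends to zero:
on `(t - 1, t]` there is an admissible time at which it is small, and it stays small up to `t`. -/
theorem tendsto_zero_of_le_add_integral {F g : ℝ → ℝ} {B : ℝ} (hB : 0 ≤ B)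
    (hF : ∀ t, 0 ≤ t → 0 ≤ F t) (hg0 : ∀ t, 0 ≤ g t) (hg : IntegrableOn g (Ioi 0))
    (hFg : ∀ᵐ s ∂(volume.restrict (Ioi (0 : ℝ))), F s ≤ B * g s)
    (hinc : ∀ η : ℝ, 0 < η → ∃ D : ℝ, 0 ≤ D ∧ ∀ᵐ s ∂(volume.restrict (Ioi (0 : ℝ))),
      ∀ t, s ≤ t → t ≤ s + 1 → F t ≤ F s + η + D * ∫ τ in s..t, g τ) :
    Tendsto F atTop (𝓝 0) := by
  have hsub : ∀ {a b : ℝ}, 0 ≤ a → a ≤ b → IntervalIntegrable g volume a b := fun ha hab =>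
    (intervalIntegrable_iff_integrableOn_Ioc_of_le hab).2
      (hg.mono_set (Ioc_subset_Ioi_self.trans (Ioi_subset_Ioi ha)))
  have hwin : Tendsto (fun t => ∫ τ in (t - 1)..t, g τ) atTop (𝓝 0) := by
    have h1 := intervalIntegral_tendsto_integral_Ioi (0 : ℝ) hg tendsto_id
    have h2 := intervalIntegral_tendsto_integral_Ioi (0 : ℝ) hg
      (tendsto_atTop_add_const_right atTop (-1 : ℝ) tendsto_id)
    have h3 := h1.sub h2
    rw [sub_self] at h3
    refine h3.congr' ?_
    filter_upwards [eventually_ge_atTop 1] with t ht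
    exact intervalIntegral.integral_interval_sub_left (hsub le_rfl (by simp; linarith))
      (hsub le_rfl (by simp; linarith))
  rw [Metric.tendsto_nhds]
  intro ε hε
  obtain ⟨D, hD, hDs⟩ := hinc (ε / 2) (half_pos hε)
  have hsmall : Tendsto (fun t => (B + D) * ∫ τ in (t - 1)..t, g τ) atTop (𝓝 0) := by
    simpa using hwin.const_mul (B + D)
  filter_upwards [eventually_ge_atTop 1, hsmall.eventually_lt_const (half_pos hε)] with t ht hlt
  have hIoc : Ioc (t - 1) t ⊆ Ioi 0 := fun s hs => lt_of_le_of_lt (by linarith) hs.1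
  have hne : volume.restrict (Ioc (t - 1) t) ≠ 0 := by
    rw [Ne, Measure.restrict_eq_zero]
    simp
  have hgood : ∀ᵐ s ∂(volume.restrict (Ioc (t - 1) t)), s ∈ Ioc (t - 1) t ∧ F s ≤ B * g s ∧
      ∀ r, s ≤ r → r ≤ s + 1 → F r ≤ F s + ε / 2 + D * ∫ τ in s..r, g τ := by
    filter_upwards [ae_restrict_mem measurableSet_Ioc, ae_restrict_of_ae_restrict_of_subset hIoc hFg,
      ae_restrict_of_ae_restrict_of_subset hIoc hDs] with s h1 h2 h3 using ⟨h1, h2, h3⟩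
  obtain ⟨s, hs, hsg⟩ := exists_notMem_null_le_average (f := g) hne
    (hg.mono_set hIoc) (ae_iff.1 hgood)
  obtain ⟨hst, hs1, hs2⟩ := not_not.1 hs
  have havg : ⨍ τ in Ioc (t - 1) t, g τ = ∫ τ in (t - 1)..t, g τ := by
    rw [setAverage_eq, intervalIntegral.integral_of_le (by linarith)]
    simp [measureReal_def]
  rw [havg] at hsg
  have hmono : ∫ τ in s..t, g τ ≤ ∫ τ in (t - 1)..t, g τ :=
    intervalIntegral.integral_mono_interval hst.1.le hst.2 le_rfl
      (Eventually.of_forall hg0) (hsub (by linarith) (by linarith))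
  have h1 := hs2 t hst.2 (by linarith [hst.1])
  have h2 := mul_le_mul_of_nonneg_left hsg hB
  have h3 := mul_le_mul_of_nonneg_left hmono hD
  rw [Real.dist_eq, sub_zero, abs_of_nonneg (hF t (by linarith))]
  linarith

namespace SolidLiquid

variable (S : SolidLiquid)

/-! ### The Euler equation -/

/-- The vector field `w ↦ -I⁻¹ · (w × I · w)` of the Euler equation. -/
noncomputable def eulerField (w : E3) : E3 := -act S.inertia⁻¹ (cross w (act S.inertia w))

theorem continuous_eulerField : Continuous S.eulerField :=
  ((continuous_act _).comp
    (continuous_cross.comp (continuous_id.prodMk (continuous_act S.inertia)))).neg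

theorem eulerField_lipschitzOnWith (R : ℝ) :
    ∃ K, LipschitzOnWith K S.eulerField (Metric.closedBall 0 R) := by
  set a := ‖actCLM S.inertia⁻¹‖
  set b := ‖actCLM S.inertia‖
  refine ⟨Real.toNNReal (a * (2 * b * R)), LipschitzOnWith.of_dist_le' fun x hx y hy => ?_⟩
  rw [mem_closedBall_zero_iff] at hx hy
  have hsplit : S.eulerField x - S.eulerField y = actCLM S.inertia⁻¹
      (cross y (actCLM S.inertia (y - x)) + cross (y - x) (actCLM S.inertia x)) := by
    simp only [eulerField, ← crossCLM_apply, ← actCLM_apply, map_sub, map_add,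
      sub_apply]
    abel
  rw [dist_eq_norm, hsplit, dist_comm, dist_eq_norm]
  have hle := (actCLM S.inertia).le_opNorm
  calc _ ≤ a * ‖cross y (actCLM S.inertia (y - x)) + cross (y - x) (actCLM S.inertia x)‖ :=
        (actCLM S.inertia⁻¹).le_opNorm _
    _ ≤ a * (R * (b * ‖y - x‖) + ‖y - x‖ * (b * R)) := by
        refine mul_le_mul_of_nonneg_left ((norm_add_le _ _).trans (add_le_add ?_ ?_))
          (norm_nonneg _)
        · exact (norm_cross_le _ _).trans
            (mul_le_mul hy (hle _) (norm_nonneg _) ((norm_nonneg y).trans hy))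
        · exact (norm_cross_le _ _).trans (mul_le_mul_of_nonneg_left
            ((hle _).trans (mul_le_mul_of_nonneg_left hx (norm_nonneg _))) (norm_nonneg _))
    _ = _ := by ring

theorem isEulerSolution_iff (w : ℝ → E3) :
    S.IsEulerSolution w ↔ IsForwardSolution S.eulerField w := by
  have hdet := S.det_inertia_ne_zero
  constructor
  · rintro ⟨h1, h2, h3⟩
    refine ⟨h2, fun t ht => ?_⟩
    have hd : HasDerivAt w (deriv w t) t :=
      ((h1.differentiableOn one_ne_zero).differentiableAt (Ioi_mem_nhds ht)).hasDerivAt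
    have : deriv w t = S.eulerField (w t) := by
      rw [eulerField, ← actCLM_apply, ← map_neg, ← eq_neg_of_add_eq_zero_left (h3 t ht),
        actCLM_apply, act_inv_act hdet]
    rwa [this] at hd
  · rintro ⟨h1, h2⟩
    refine ⟨?_, h1, fun t ht => ?_⟩
    · rw [show (1 : WithTop ℕ∞) = 0 + 1 from rfl, contDiffOn_succ_iff_deriv_of_isOpen isOpen_Ioi]
      refine ⟨fun t ht => (h2 t ht).differentiableAt.differentiableWithinAt, by simp, ?_⟩
      rw [contDiffOn_zero]
      exact (S.continuous_eulerField.comp_continuousOn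
        (h1.mono Ioi_subset_Ici_self)).congr fun t ht => (h2 t ht).deriv
    · rw [(h2 t ht).deriv, eulerField, ← actCLM_apply S.inertia, map_neg, actCLM_apply,
        act_act_inv hdet, neg_add_cancel]

/-- The cluster set of a curve that is asymptotically driven by the Euler equation is invariant. -/
theorem isEulerInvariant_clusterSet {e u : ℝ → E3}
    (hu : IsAsymptoticSolution S.eulerField e u) : S.IsEulerInvariant (clusterSet u) := by
  have hc := S.continuous_eulerField
  have hL := S.eulerField_lipschitzOnWith
  refine ⟨fun p hp => ?_, fun t ht => Subset.antisymm ?_ fun q hq => ?_⟩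
  · obtain ⟨w, hw, h0⟩ := hu.exists_forwardSolution hc hL hp
    exact ⟨w, (S.isEulerSolution_iff w).2 hw, h0⟩
  · rintro _ ⟨w, hw, h0, rfl⟩
    exact hu.mem_clusterSet_of_forwardSolution hc hL ((S.isEulerSolution_iff w).1 hw) h0 ht
  · obtain ⟨w, hw, h0, hwt⟩ := hu.exists_forwardSolution_of_mem_clusterSet hc hL hq ht
    exact ⟨w, (S.isEulerSolution_iff w).2 hw, h0, hwt⟩

/-! ### Asymptotics of weak solutions -/

variable {S} {v : ℝ → S.H} {ω : ℝ → E3}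

theorem energy_eq (u : VecL2 S.cavity) (w : E3) :
    S.energy u w = (1 / 2) * (S.liquidEnergy u + inner ℝ w (act S.inertia w)) := rfl

namespace IsWeakSolution

theorem continuousOn_moment (h : S.IsWeakSolution v ω) :
    ContinuousOn (fun t => moment (v t : VecL2 S.cavity)) (Ici 0) := by
  have hcoord : ∀ b : E3, ContinuousOn (fun t => inner ℝ b (moment (v t : VecL2 S.cavity)))
      (Ici 0) := by
    intro b
    refine (h.1 ((innerSL ℝ ((memLp_cross S.isOpen_cavity S.bounded_cavity b).toLp _)).comp
      (solenoidal S.cavity).subtypeL)).congr fun t _ => ?_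
    exact inner_moment S.isOpen_cavity S.bounded_cavity b _
  have hsum : (fun t => moment (v t : VecL2 S.cavity)) = fun t =>
      ∑ i, inner ℝ (EuclideanSpace.basisFun (Fin 3) ℝ i) (moment (v t : VecL2 S.cavity)) •
        EuclideanSpace.basisFun (Fin 3) ℝ i := by
    funext t
    exact ((EuclideanSpace.basisFun (Fin 3) ℝ).sum_repr' _).symm
  rw [hsum]
  exact continuousOn_finsetSum _ fun i _ => (hcoord _).smul continuousOn_const

theorem continuousOn_aVec (h : S.IsWeakSolution v ω) :
    ContinuousOn (fun t => S.aVec (v t)) (Ici 0) :=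
  ((h.continuousOn_moment.act S.inertia⁻¹).const_smul S.rho).neg

theorem continuousOn_omega (h : S.IsWeakSolution v ω) : ContinuousOn ω (Ici 0) := h.2.2.2.1

/-- The differential form of the conservation of total angular momentum. -/
theorem hasDerivAt_momentum (h : S.IsWeakSolution v ω) {t : ℝ} (ht : 0 < t) :
    HasDerivAt (fun τ => act S.inertia (ω τ))
      (-cross (ω t + S.aVec (v t)) (act S.inertia (ω t))) t := by
  have ha := h.continuousOn_aVec
  obtain ⟨-, -, -, hω, -, -, -, -, -, -, hmom⟩ := h
  have hf : ContinuousOn (fun τ => cross (ω τ + S.aVec (v τ)) (act S.inertia (ω τ))) (Ici 0) :=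
    (hω.add ha).cross (hω.act _)
  exact hasDerivAt_of_eq_sub_integral hf hmom ht

theorem hasDerivAt_omega (h : S.IsWeakSolution v ω) {t : ℝ} (ht : 0 < t) :
    HasDerivAt ω (S.eulerField (ω t)
      + -act S.inertia⁻¹ (cross (S.aVec (v t)) (act S.inertia (ω t)))) t := by
  have hd := (actCLM S.inertia⁻¹).hasFDerivAt.comp_hasDerivAt t (h.hasDerivAt_momentum ht)
  have hω : actCLM S.inertia⁻¹ ∘ (fun τ => act S.inertia (ω τ)) = ω :=
    funext fun τ => act_inv_act S.det_inertia_ne_zero (ω τ)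
  have hval : actCLM S.inertia⁻¹ (-cross (ω t + S.aVec (v t)) (act S.inertia (ω t)))
      = S.eulerField (ω t) + -act S.inertia⁻¹ (cross (S.aVec (v t)) (act S.inertia (ω t))) := by
    simp only [eulerField, ← actCLM_apply, ← crossCLM_apply, map_neg, map_add, add_apply]
    abel
  rwa [hω, hval] at hd

/-- Twice the kinetic energy `½ ω_∞ · I · ω_∞` of the rotation changes only through the coupling with the liquid. -/
theorem hasDerivAt_rotationEnergy (h : S.IsWeakSolution v ω) {t : ℝ} (ht : 0 < t) :
    HasDerivAt (fun τ => inner ℝ (ω τ) (act S.inertia (ω τ)))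
      (-2 * inner ℝ (ω t) (cross (S.aVec (v t)) (act S.inertia (ω t)))) t := by
  have hd := (h.hasDerivAt_omega ht).inner ℝ (h.hasDerivAt_momentum ht)
  have hself : inner ℝ (ω t) (cross (ω t) (act S.inertia (ω t))) = (0 : ℝ) :=
    inner_self_cross _ _
  have hJ : ∀ y, inner ℝ (act S.inertia⁻¹ y) (act S.inertia (ω t)) = (inner ℝ (ω t) y : ℝ) := by
    intro y
    rw [S.inner_act_inertia_comm, act_act_inv S.det_inertia_ne_zero]
  have hadd : cross (ω t + S.aVec (v t)) (act S.inertia (ω t))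
      = cross (ω t) (act S.inertia (ω t)) + cross (S.aVec (v t)) (act S.inertia (ω t)) := by
    simp only [← crossCLM_apply, map_add, add_apply]
  rw [eulerField, inner_add_left, inner_neg_left, inner_neg_left, hJ, hJ, hadd, inner_neg_right,
    inner_add_right, hself] at hd
  refine hd.congr_deriv ?_
  ring

/-- The total energy does not exceed its initial value. -/
theorem energy_le_energy_zero (h : S.IsWeakSolution v ω) {t : ℝ} (ht : 0 ≤ t) :
    S.energy (v t) (ω t) ≤ S.energy (v 0) (ω 0) := by
  obtain ⟨-, -, -, -, Dv, -, -, hE, -⟩ := h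
  have h0 : 0 ≤ S.mu * ∫ τ in (0 : ℝ)..t, ‖grad (Dv τ)‖ ^ 2 :=
    mul_nonneg S.mu_pos.le (intervalIntegral.integral_nonneg ht fun _ _ => by positivity)
  linarith [hE t ht]

theorem exists_norm_omega_le (h : S.IsWeakSolution v ω) : ∃ R, ∀ t, 0 ≤ t → ‖ω t‖ ≤ R := by
  obtain ⟨c, hc, hcoer⟩ := S.exists_inertia_coercive
  obtain ⟨δ, hδ, hliq⟩ := S.exists_liquidEnergy_coercive
  refine ⟨√(2 * S.energy (v 0) (ω 0) / c), fun t ht => Real.le_sqrt_of_sq_le ?_⟩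
  rw [le_div_iff₀ hc]
  have h1 := h.energy_le_energy_zero ht
  rw [energy_eq (v t : VecL2 S.cavity)] at h1
  have h2 := hcoer (ω t)
  have h3 := hliq (v t)
  have h4 : 0 ≤ δ * ‖(v t : VecL2 S.cavity)‖ ^ 2 := by positivity
  linarith

/-- The velocity of the liquid tends to zero in `L²`. By the energy inequality and the Poincaré
inequality `‖v‖₂²` is integrable in time, and the liquid energy can only grow by the power
`ω_∞ · (a × I · ω_∞)`, which is bounded by a multiple of `‖v‖₂`. -/
theorem tendsto_norm_zero (h : S.IsWeakSolution v ω) :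
    Tendsto (fun t => ‖v t‖) atTop (𝓝 0) := by
  obtain ⟨δ, hδ, hcoer⟩ := S.exists_liquidEnergy_coercive
  obtain ⟨B, hB, hpoin⟩ := exists_norm_field_le S.bounded_cavity
  obtain ⟨A, hA, haVec⟩ := S.exists_norm_aVec_le
  obtain ⟨R, hR⟩ := h.exists_norm_omega_le
  have hω := h.continuousOn_omega
  have ha := h.continuousOn_aVec
  have hrot := fun t => h.hasDerivAt_rotationEnergy (t := t)
  obtain ⟨-, -, -, -, Dv, hDv, hfield, -, hE, -, -⟩ := h
  set Q := ‖actCLM S.inertia‖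
  have hR0 : 0 ≤ R := (norm_nonneg _).trans (hR 0 le_rfl)
  have hgrad : MemLp (fun t => grad (Dv t)) 2 (volume.restrict (Ioi (0 : ℝ))) := by
    refine hDv.of_le ?_ (Eventually.of_forall fun t => ?_)
    · exact ((WithLp.continuous_snd ..).comp continuous_subtype_val).comp_aestronglyMeasurable
        hDv.aestronglyMeasurable
    · exact WithLp.norm_snd_le _ _
  have hint : IntegrableOn (fun t => ‖grad (Dv t)‖ ^ 2) (Ioi 0) :=
    (memLp_two_iff_integrable_sq_norm hgrad.aestronglyMeasurable).1 hgrad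
  have hv : ∀ᵐ t ∂(volume.restrict (Ioi (0 : ℝ))), ‖(v t : VecL2 S.cavity)‖
      ≤ B * ‖grad (Dv t)‖ := by
    filter_upwards [hfield] with t ht
    rw [← ht]
    exact hpoin _
  have hF0 : ∀ t, 0 ≤ S.liquidEnergy (v t) := fun t =>
    (by positivity : 0 ≤ δ * ‖(v t : VecL2 S.cavity)‖ ^ 2).trans (hcoer _)
  have hlim : Tendsto (fun t => S.liquidEnergy (v t)) atTop (𝓝 0) := by
    refine tendsto_zero_of_le_add_integral (B := S.rho * B ^ 2)
      (mul_nonneg S.rho_pos.le (by positivity)) (fun t _ => hF0 t)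
      (fun t => by positivity) hint ?_ fun η hη => ?_
    · filter_upwards [hv] with s hs
      calc _ ≤ S.rho * ‖(v s : VecL2 S.cavity)‖ ^ 2 := S.liquidEnergy_le _
        _ ≤ S.rho * (B * ‖grad (Dv s)‖) ^ 2 := by gcongr; exact S.rho_pos.le
        _ = _ := by ring
    · set M := 2 * (R * (A * (Q * R))) * B
      have hM : 0 ≤ M := by positivity
      -- Young's inequality `M x ≤ η + M² x² / (4 η)` trades the power for the dissipation.
      refine ⟨M ^ 2 / (4 * η), by positivity, ?_⟩
      filter_upwards [hE, ae_restrict_mem measurableSet_Ioi] with s hs hs0 t hst hts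
      rw [mem_Ioi] at hs0
      have hsub : uIcc s t ⊆ Ioi 0 := by
        rw [uIcc_of_le hst]
        exact fun x hx => hs0.trans_le hx.1
      have hsub' : uIcc s t ⊆ Ici 0 := hsub.trans Ioi_subset_Ici_self
      have hii : IntervalIntegrable (fun τ => ‖grad (Dv τ)‖ ^ 2) volume s t :=
        (intervalIntegrable_iff_integrableOn_Ioc_of_le hst).2
          (hint.mono_set fun x hx => hs0.trans hx.1)
      have hpow : ContinuousOn (fun τ => -2 * inner ℝ (ω τ)
          (cross (S.aVec (v τ)) (act S.inertia (ω τ)))) (Ici 0) :=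
        continuousOn_const.mul (hω.inner (ha.cross (hω.act _)))
      have hftc := intervalIntegral.integral_eq_sub_of_hasDerivAt (a := s) (b := t)
        (fun τ hτ => hrot τ (hsub hτ)) (hpow.mono hsub').intervalIntegrable
      have hbound : ∀ᵐ τ ∂volume, τ ∈ Ioc s t →
          ‖-2 * inner ℝ (ω τ) (cross (S.aVec (v τ)) (act S.inertia (ω τ)))‖
            ≤ η + M ^ 2 / (4 * η) * ‖grad (Dv τ)‖ ^ 2 := by
        filter_upwards [(ae_restrict_iff' measurableSet_Ioi).1 hv] with τ hτ hτst
        have hτ0 : 0 < τ := hs0.trans hτst.1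
        have hRτ := hR τ hτ0.le
        have hyoung : M * ‖grad (Dv τ)‖ ≤ η + M ^ 2 / (4 * η) * ‖grad (Dv τ)‖ ^ 2 := by
          have : η + M ^ 2 / (4 * η) * ‖grad (Dv τ)‖ ^ 2 - M * ‖grad (Dv τ)‖
              = (2 * η - M * ‖grad (Dv τ)‖) ^ 2 / (4 * η) := by
            field_simp
            ring
          have : 0 ≤ (2 * η - M * ‖grad (Dv τ)‖) ^ 2 / (4 * η) := by positivity
          linarith
        refine le_trans ?_ hyoung
        rw [norm_mul, norm_neg, Real.norm_ofNat]
        calc 2 * ‖inner ℝ (ω τ) (cross (S.aVec (v τ)) (act S.inertia (ω τ)))‖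
            ≤ 2 * (R * (A * (B * ‖grad (Dv τ)‖) * (Q * R))) := by
              refine mul_le_mul_of_nonneg_left ?_ zero_le_two
              refine (norm_inner_le_norm _ _).trans (mul_le_mul hRτ ?_ (norm_nonneg _) hR0)
              refine (norm_cross_le _ _).trans (mul_le_mul ?_ ?_ (norm_nonneg _) (by positivity))
              · exact (haVec _).trans (mul_le_mul_of_nonneg_left (hτ hτ0) hA)
              · exact ((actCLM S.inertia).le_opNorm _).trans
                  (mul_le_mul_of_nonneg_left hRτ (norm_nonneg _))
          _ = _ := by ring
      have hnorm := intervalIntegral.norm_integral_le_of_norm_le hst hbound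
        (intervalIntegrable_const.add (hii.const_mul _))
      rw [hftc, intervalIntegral.integral_add intervalIntegrable_const (hii.const_mul _),
        intervalIntegral.integral_const, intervalIntegral.integral_const_mul, smul_eq_mul,
        Real.norm_eq_abs] at hnorm
      have hη1 : (t - s) * η ≤ η := mul_le_of_le_one_left hη.le (by linarith)
      have hdiss : 0 ≤ S.mu * ∫ τ in s..t, ‖grad (Dv τ)‖ ^ 2 :=
        mul_nonneg S.mu_pos.le (intervalIntegral.integral_nonneg hst fun _ _ => by positivity)
      have hEst := hs t hst
      rw [energy_eq (v t : VecL2 S.cavity), energy_eq (v s : VecL2 S.cavity)] at hEst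
      have habs := (abs_le.1 hnorm).1
      linarith
  have hsq : Tendsto (fun t => ‖v t‖ ^ 2) atTop (𝓝 0) := by
    refine squeeze_zero (fun t => by positivity) (fun t => ?_) (by simpa using hlim.const_mul δ⁻¹)
    rw [← div_eq_inv_mul, le_div_iff₀ hδ, mul_comm]
    exact hcoer _
  simpa using hsq.sqrt

theorem isAsymptoticSolution (h : S.IsWeakSolution v ω) :
    IsAsymptoticSolution S.eulerField
      (fun t => -act S.inertia⁻¹ (cross (S.aVec (v t)) (act S.inertia (ω t)))) ω where
  continuousOn := h.continuousOn_omega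
  bounded := h.exists_norm_omega_le
  hasDerivAt _ ht := h.hasDerivAt_omega ht
  continuousOn_error := by
    refine ContinuousOn.mono ?_ Ioi_subset_Ici_self
    exact ((h.continuousOn_aVec.cross (h.continuousOn_omega.act _)).act _).neg
  tendsto_error := by
    obtain ⟨A, hA, haVec⟩ := S.exists_norm_aVec_le
    obtain ⟨R, hR⟩ := h.exists_norm_omega_le
    refine squeeze_zero_norm' (a := fun t => ‖actCLM S.inertia⁻¹‖ * (‖actCLM S.inertia‖ * R) * A
      * ‖v t‖) ?_ (by simpa using h.tendsto_norm_zero.const_mul _)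
    filter_upwards [eventually_ge_atTop 0] with t ht
    rw [norm_neg]
    calc _ ≤ ‖actCLM S.inertia⁻¹‖ * ‖cross (S.aVec (v t)) (act S.inertia (ω t))‖ :=
          (actCLM S.inertia⁻¹).le_opNorm _
      _ ≤ ‖actCLM S.inertia⁻¹‖ * ((A * ‖v t‖) * (‖actCLM S.inertia‖ * R)) := by
          refine mul_le_mul_of_nonneg_left ?_ (norm_nonneg _)
          refine (norm_cross_le _ _).trans
            (mul_le_mul (haVec _) ?_ (norm_nonneg _) (by positivity))
          exact ((actCLM S.inertia).le_opNorm _).trans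
            (mul_le_mul_of_nonneg_left (hR t ht) (norm_nonneg _))
      _ = _ := by ring

theorem limitSet_eq (h : S.IsWeakSolution v ω) :
    S.limitSet v ω = {(0 : S.H)} ×ˢ clusterSet ω := by
  have hv : Tendsto v atTop (𝓝 0) := tendsto_zero_iff_norm_tendsto_zero.2 h.tendsto_norm_zero
  ext ⟨V, p⟩
  rw [mem_prod, mem_singleton_iff]
  constructor
  · rintro ⟨t, -, -, ht, hlim⟩
    have h1 : Tendsto (fun n => v (t n)) atTop (𝓝 V) :=
      tendsto_iff_norm_sub_tendsto_zero.2 (squeeze_zero (fun _ => norm_nonneg _)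
        (fun _ => le_add_of_nonneg_right (norm_nonneg _)) hlim)
    have h2 : Tendsto (fun n => ω (t n)) atTop (𝓝 p) :=
      tendsto_iff_norm_sub_tendsto_zero.2 (squeeze_zero (fun _ => norm_nonneg _)
        (fun _ => le_add_of_nonneg_left (norm_nonneg _)) hlim)
    exact ⟨tendsto_nhds_unique h1 (hv.comp ht), mem_clusterSet_of_tendsto ht h2⟩
  · rintro ⟨rfl, hp⟩
    obtain ⟨t, hpos, hmono, ht, hlim⟩ := exists_seq_of_mem_clusterSet hp
    refine ⟨t, hpos, hmono, ht, ?_⟩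
    simpa using (tendsto_iff_norm_sub_tendsto_zero.1 (hv.comp ht)).add
      (tendsto_iff_norm_sub_tendsto_zero.1 hlim)

end IsWeakSolution

end SolidLiquid

end LiquidBody

theorem proposition3 (S : LiquidBody.SolidLiquid) (v : ℝ → S.H) (ω : ℝ → LiquidBody.E3)
    (h : S.IsWeakSolution v ω) :
    (S.limitSet v ω).Nonempty ∧
      ∃ A : Set LiquidBody.E3, S.limitSet v ω = {(0 : S.H)} ×ˢ A ∧
        IsCompact A ∧ IsConnected A ∧ S.IsEulerInvariant A := by
  obtain ⟨R, hR⟩ := h.exists_norm_omega_le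
  refine ⟨?_, LiquidBody.clusterSet ω, h.limitSet_eq, LiquidBody.isCompact_clusterSet hR,
    LiquidBody.isConnected_clusterSet hR h.continuousOn_omega,
    S.isEulerInvariant_clusterSet h.isAsymptoticSolution⟩
  rw [h.limitSet_eq]
  exact (singleton_nonempty _).prod (LiquidBody.clusterSet_nonempty hR)
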